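/- For a prime number $p$, let $\Gamma_p = \mathrm{PGL}_2(\mathbb{Z}/p\mathbb{Z})$, a finite group with the discrete topology. There exist a sequence of prime numbers $(p_n)_{n \ge 1}$ tending to infinity, a closed subset $F$ of the compact group $K = \prod_{n=1}^\infty \Gamma_{p_n}$ (with the product topology), and a Borel probability measure $\nu$ on $K$ such that: 1. $F$ is free, i.e. $g_1^{\varepsilon_1} \cdots g_m^{\varepsilon_m} \neq e$ for all $m \ge 1$, $g_1,\dots,g_m \in F$ and $\varepsilon_1,\dots,\varepsilon_m \in \{\pm 1\}$ such that $\varepsilon_i = \varepsilon_{i+1}$ whenever $1 \le i \le m-1$ and $g_i = g_{i+1}$; 2. $F$ topologically generates $K$, i.e. the subgroup generated by $F$ is dense in $K$; 3. $\nu$ is symmetric (invariant under $x \mapsto x^{-1}$) and non-atomic; 4. $\nu$ is $c_0$, i.e. the operator $\lambda(\nu) = \int_K \lambda(x)\, d\nu(x)$ on $L^2(K)$ is compact, where $L^2(K)$ is taken with respect to the Haar probability measure and $\lambda$ is the left regular representation, $(\lambda(x)\xi)(y) = \xi(x^{-1}y)$; 5. the support of $\nu$, i.e. the smallest closed subset $S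 \subset K$ with $\nu(S) = 1$, equals $F \cup F^{-1}$. -/

import Mathlib

open MeasureTheory Filter Topology
open scoped MatrixGroups Pointwise

noncomputable section

/-- A subset `F` of a group is *free* if no nontrivial reduced word `g₁^{ε₁} ⋯ gₙ^{εₙ}`, `n ≥ 1`,
`gᵢ ∈ F`, `εᵢ = ±1`, equals the identity. Reduced means: `εᵢ = εᵢ₊₁` whenever `gᵢ = gᵢ₊₁`.
A letter `g ^ ε` is encoded as the pair `(g, b)`, with `b = true` for `ε = 1` and `b = false`
for `ε = -1`. -/
def IsFreeSubset {G : Type*} [Group G] (F : Set G) : Prop :=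
  ∀ w : List (G × Bool), w ≠ [] → (∀ a ∈ w, a.1 ∈ F) →
    w.IsChain (fun a b => a.1 = b.1 → a.2 = b.2) →
    (w.map fun a => if a.2 then a.1 else a.1⁻¹).prod ≠ 1

section CompactGroup

variable (K : Type*) [Group K] [TopologicalSpace K] [IsTopologicalGroup K] [CompactSpace K]
  [MeasurableSpace K] [BorelSpace K]

/-- The Haar probability measure of a compact group. -/
def haarProb : Measure K := Measure.haarMeasure (⊤ : TopologicalSpace.PositiveCompacts K)

instance : (haarProb K).IsHaarMeasure := by unfold haarProb; infer_instance

instance : (haarProb K).Regular := by unfold haarProb; infer_instance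

instance : IsProbabilityMeasure (haarProb K) :=
  ⟨Measure.haarMeasure_self (K₀ := (⊤ : TopologicalSpace.PositiveCompacts K))⟩

/-- The complex Hilbert space `L²(K)`. -/
abbrev L2 : Type _ := Lp ℂ 2 (haarProb K)

variable {K}

/-- The left regular representation: `(λ(x) ξ)(y) = ξ(x⁻¹ y)`. -/
def leftRegular (x : K) : L2 K →ₗᵢ[ℂ] L2 K :=
  Lp.compMeasurePreservingₗᵢ ℂ (fun y => x⁻¹ * y) (measurePreserving_mul_left (haarProb K) x⁻¹)

theorem continuous_leftRegular (ξ : L2 K) : Continuous fun x : K => leftRegular x ξ := by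
  have : Fact ((2 : ENNReal) ≠ ⊤) := ⟨ENNReal.ofNat_ne_top⟩
  have h : Continuous fun x : K => DomMulAct.mk x⁻¹ • ξ :=
    (DomMulAct.continuous_mk.comp continuous_inv).smul continuous_const
  exact h

theorem integrable_leftRegular (ν : Measure K) [IsFiniteMeasure ν] (ξ : L2 K) :
    Integrable (fun x : K => leftRegular x ξ) ν :=
  (continuous_leftRegular ξ).integrable_of_hasCompactSupport
    (HasCompactSupport.of_compactSpace _)

/-- The convolution operator `λ(ν) = ∫ λ(x) dν(x)` on `L²(K)`. -/
def convOp (ν : Measure K) [IsProbabilityMeasure ν] : L2 K →L[ℂ] L2 K :=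
  LinearMap.mkContinuous
    { toFun := fun ξ => ∫ x, leftRegular x ξ ∂ν
      map_add' := fun ξ η => by
        simp only [map_add]
        exact integral_add (integrable_leftRegular ν ξ) (integrable_leftRegular ν η)
      map_smul' := fun c ξ => by
        simp only [map_smul, RingHom.id_apply]
        exact integral_smul c _ } 1
    (fun ξ => by
      have h := norm_integral_le_of_norm_le_const (μ := ν) (f := fun x : K => leftRegular x ξ)
        (C := ‖ξ‖) (ae_of_all _ fun x => ((leftRegular x).norm_map ξ).le)
      simpa using h)

/-- A probability measure `ν` on a compact group is `c₀` if `λ(ν)` is a compact operator. -/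
def IsC0 (ν : Measure K) [IsProbabilityMeasure ν] : Prop :=
  IsCompactOperator (convOp ν)

end CompactGroup

/-- The finite group `PGL₂(ℤ/pℤ)`, `p` a prime number. -/
abbrev PGLTwo (p : Nat.Primes) : Type := PGL(2, ZMod p)

/-- The finite group `PGL₂(ℤ/pℤ)` carries the discrete topology. -/
instance (p : Nat.Primes) : TopologicalSpace (PGLTwo p) := ⊥

instance (p : Nat.Primes) : DiscreteTopology (PGLTwo p) := ⟨rfl⟩

/-- All subsets of the finite group `PGL₂(ℤ/pℤ)` are measurable. -/
instance (p : Nat.Primes) : MeasurableSpace (PGLTwo p) := ⊤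

instance (p : Nat.Primes) : DiscreteMeasurableSpace (PGLTwo p) := ⟨fun _ => trivial⟩

instance (p : Nat.Primes) : Finite (PGLTwo p) :=
  haveI : NeZero (p : ℕ) := ⟨p.2.ne_zero⟩
  Finite.of_surjective _ Matrix.ProjGenLinGroup.mk_surjective

/-- The compact group `∏ₙ PGL₂(ℤ/pₙℤ)`, with the product topology and the product (equivalently,
Borel) σ-algebra. -/
abbrev ProdPGLTwo (p : ℕ → Nat.Primes) : Type := ∀ n, PGLTwo (p n)

end

/-! Let `X` be the product of cyclic groups of orders `r n ≥ 2`, with Haar measure `μ`. The set `F`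
is the range of an injective continuous map `φ` on `X`, and `ν` is the symmetrized image of `μ`. The
coordinate `φ x n` is taken from a finite family in the `n`-th factor, arranged in rows: the prefix
`x 0, …, x (n - 1)` selects the row and `x n` the entry in it. Two properties of these families
carry the proof.

Large girth: no short nontrivial reduced word in the whole `n`-th family is trivial. Distinct points
of `X` have distinct indices from some coordinate on, so a reduced word in `F` stays reduced in a
late coordinate, where it is shorter than the girth (`isFreeSubset_range`).

Small averages: in every unitary representation the average over a row is within `1 / (n + 2)` of
the projection on the fixed vectors. That projection kills the functions of the first `n + 1`
coordinates orthogonal to those of the first `n`. Conditioning on the prefix then bounds `λ(ν)`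
there by `1 / (n + 2)` (`norm_integral_leftRegular_le`). Hence `λ(ν)` is compact, and its norm on
mean zero functions is at most `1 / 2`, which rules out a proper closed subgroup containing `F`.

Such families exist by counting (`exists_family`). A fixed reduced word is trivial with probability
`O(length / p)`, since an entry of the matrix word is a polynomial that does not vanish identically.
Averages are controlled by the trace method: a word with a letter occurring exactly once is trivial
with probability `1 / |G|`, and only `O(r ^ (m / 2))` words of length `m` have no such letter. For
`p` between `r ^ D` and `2 r ^ D`, with suitable `D` and `m`, both bounds win when `r` is large. -/

noncomputable section

/-! ### Random words in a finite group -/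

section SignedWord

variable {G ι : Type*} [Group G] {m : ℕ}

/-- The value `∏ₖ h (f k) ^ (± 1)` of the word with letters `f k` and signs `s k`. -/
def signedWord (h : ι → G) (s : Fin m → Bool) (f : Fin m → ι) : G :=
  (List.ofFn fun k => if s k then h (f k) else (h (f k))⁻¹).prod

lemma signedWord_succ (h : ι → G) (s : Fin (m + 1) → Bool) (f : Fin (m + 1) → ι) :
    signedWord h s f =
      (if s 0 then h (f 0) else (h (f 0))⁻¹) * signedWord h (Fin.tail s) (Fin.tail f) := by
  simp only [signedWord, List.ofFn_succ, Fin.tail, List.prod_cons]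
  rfl

lemma signedWord_update_of_ne [DecidableEq ι] (h : ι → G) (s : Fin m → Bool) (f : Fin m → ι)
    {i : ι} (hi : ∀ k, f k ≠ i) (g : G) :
    signedWord (Function.update h i g) s f = signedWord h s f := by
  simp [signedWord, Function.update_of_ne (hi _)]

/-- The varying letter appears once, so the word is `u * g ^ (± 1) * v` with `u`, `v` independent of
`g`. -/
lemma bijective_signedWord_update [DecidableEq ι] (h : ι → G) (s : Fin m → Bool) (f : Fin m → ι)
    (k₀ : Fin m) (hk : ∀ k, f k = f k₀ → k = k₀) :
    Function.Bijective fun g => signedWord (Function.update h (f k₀) g) s f := by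
  induction m with
  | zero => exact k₀.elim0
  | succ m ih =>
    simp only [signedWord_succ]
    cases k₀ using Fin.cases with
    | zero =>
      have h1 : ∀ k, Fin.tail f k ≠ f 0 := fun k hk' => Fin.succ_ne_zero k (hk _ hk')
      simp only [signedWord_update_of_ne h _ _ h1, Function.update_self]
      refine (Group.mulRight_bijective _).comp (f := fun g => if s 0 then g else g⁻¹) ?_
      cases s 0 with
      | true => exact Function.bijective_id
      | false => exact (Equiv.inv G).bijective
    | succ k₁ =>
      have h1 : f 0 ≠ f k₁.succ := fun hk' => (Fin.succ_ne_zero k₁) (hk _ hk').symm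
      simp only [Function.update_of_ne h1]
      refine (Group.mulLeft_bijective _).comp ?_
      exact ih (Fin.tail s) (Fin.tail f) k₁ fun k hk' => Fin.succ_injective _ (hk _ hk')

/-- If some letter occurs exactly once in a word, then the word is trivial on a proportion
`1 / |G|` of all tuples. -/
lemma card_signedWord_eq_one [Fintype G] [DecidableEq G] [Fintype ι] [DecidableEq ι]
    (s : Fin m → Bool) (f : Fin m → ι) (k₀ : Fin m) (hk : ∀ k, f k = f k₀ → k = k₀) :
    Fintype.card G * (Finset.univ.filter fun h : ι → G => signedWord h s f = 1).card =
      Fintype.card (ι → G) := by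
  set i := f k₀
  -- Resampling: swapping the `i`-th coordinate with an auxiliary variable preserves the counting
  -- measure, and for fixed `h` exactly one value of that variable makes the word trivial.
  let σ : Equiv.Perm ((ι → G) × G) :=
    Function.Involutive.toPerm (fun x => (Function.update x.1 i x.2, x.1 i)) (by
      rintro ⟨h, g⟩; simp)
  have h1 : ∑ x : (ι → G) × G, (if signedWord x.1 s f = 1 then 1 else 0) =
      ∑ x : (ι → G) × G, (if signedWord (Function.update x.1 i x.2) s f = 1 then 1 else 0) :=
    (Equiv.sum_comp σ fun x : (ι → G) × G => if signedWord x.1 s f = 1 then 1 else 0).symm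
  rw [Fintype.sum_prod_type, Fintype.sum_prod_type] at h1
  have h2 : ∀ h : ι → G,
      ∑ g : G, (if signedWord (Function.update h i g) s f = 1 then 1 else 0) = 1 := fun h => by
    obtain ⟨g₀, hg₀, hu⟩ := (bijective_signedWord_update h s f k₀ hk).existsUnique 1
    rw [Finset.sum_eq_single g₀]
    · simpa using hg₀
    · intro g _ hg
      exact if_neg fun h' => hg (hu g h')
    · simp
  simp only [h2, Finset.sum_const, smul_eq_mul, mul_one, Finset.card_univ] at h1
  rw [← h1, Finset.card_filter, Finset.mul_sum]
  exact Finset.sum_congr rfl fun h _ => by split_ifs <;> simp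

/-- Every value is taken at least twice, so there are at most `m / 2` values and `f` factors through
`Fin (m / 2)`. -/
lemma card_forall_exists_ne_le {α : Type*} [Fintype α] [DecidableEq α] (m : ℕ) :
    (Finset.univ.filter fun f : Fin m → α => ∀ k, ∃ k', k' ≠ k ∧ f k' = f k).card ≤
      Fintype.card α ^ (m / 2) * (m / 2) ^ m := by
  rcases Nat.eq_zero_or_pos m with rfl | hm
  · simp
  have key : (Finset.univ.filter fun f : Fin m → α => ∀ k, ∃ k', k' ≠ k ∧ f k' = f k) ⊆
      (Finset.univ : Finset ((Fin (m / 2) → α) × (Fin m → Fin (m / 2)))).image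
        fun x => x.1 ∘ x.2 := by
    intro f hf
    simp only [Finset.mem_filter, Finset.mem_univ, true_and] at hf
    have h1 : 2 * (Finset.univ.image f).card ≤ (Finset.univ : Finset (Fin m)).card := by
      apply Finset.mul_card_image_le_card
      intro a ha
      obtain ⟨k, -, rfl⟩ := Finset.mem_image.1 ha
      obtain ⟨k', h1, h2⟩ := hf k
      exact Finset.one_lt_card.2 ⟨k, by simp, k', by simpa using h2, h1.symm⟩
    rw [Finset.card_univ, Fintype.card_fin] at h1
    obtain ⟨e⟩ : Nonempty ((Finset.univ.image f) ↪ Fin (m / 2)) := by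
      apply Function.Embedding.nonempty_of_card_le
      simp only [Fintype.card_coe, Fintype.card_fin]
      lia
    have : Nonempty (Finset.univ.image f) := ⟨⟨f ⟨0, hm⟩, by simp⟩⟩
    refine Finset.mem_image.2 ⟨(fun t => ((Function.invFun e t : Finset.univ.image f) : α),
      fun k => e ⟨f k, by simp⟩), Finset.mem_univ _, ?_⟩
    ext k
    simp [Function.leftInverse_invFun e.injective _]
  refine (Finset.card_le_card key).trans (Finset.card_image_le.trans ?_)
  simp [Fintype.card_prod]

/-- First moment of the number of trivial words: words with a letter occurring once contribute the
main term, and the few others are bounded trivially. -/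
lemma card_mul_sum_card_signedWord_le [Fintype G] [DecidableEq G] [Fintype ι] [DecidableEq ι]
    {α : Type*} [Fintype α] [DecidableEq α] (e : α ↪ ι) (s : Fin m → Bool) :
    Fintype.card G * ∑ h : ι → G,
        (Finset.univ.filter fun f : Fin m → α => signedWord h s (e ∘ f) = 1).card ≤
      Fintype.card (ι → G) * (Fintype.card α ^ m +
        Fintype.card G * (Fintype.card α ^ (m / 2) * (m / 2) ^ m)) := by
  have h1 : ∑ h : ι → G, (Finset.univ.filter fun f : Fin m → α => signedWord h s (e ∘ f) = 1).card
      = ∑ f : Fin m → α, (Finset.univ.filter fun h : ι → G => signedWord h s (e ∘ f) = 1).card := by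
    simp only [Finset.card_filter]
    exact Finset.sum_comm
  rw [h1, ← Finset.sum_filter_add_sum_filter_not _
    (fun f : Fin m → α => ∀ k, ∃ k', k' ≠ k ∧ f k' = f k), mul_add, add_comm, mul_add]
  refine add_le_add ?_ ?_
  · rw [Finset.mul_sum]
    refine (Finset.sum_le_card_nsmul _ _ (Fintype.card (ι → G)) ?_).trans ?_
    · intro f hf
      simp only [Finset.mem_filter, Finset.mem_univ, true_and, not_forall, not_exists] at hf
      obtain ⟨k₀, hk₀⟩ := hf
      refine (card_signedWord_eq_one s (e ∘ f) k₀ fun k hk => ?_).le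
      by_contra hne
      exact hk₀ k ⟨hne, e.injective hk⟩
    · rw [smul_eq_mul, mul_comm]
      refine Nat.mul_le_mul_left _ ((Finset.card_filter_le _ _).trans ?_)
      simp
  · rw [mul_left_comm]
    refine Nat.mul_le_mul_left _ ?_
    refine (Finset.sum_le_card_nsmul _ _ (Fintype.card (ι → G)) fun f _ => ?_).trans ?_
    · exact Finset.card_filter_le _ _
    · rw [smul_eq_mul, mul_comm]
      exact Nat.mul_le_mul_left _ (card_forall_exists_ne_le m)

end SignedWord

/-! ### Matrix words and the probability that a word in `PGL₂` is trivial -/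

section ListWord

variable {ι : Type*}

/-- The value of a word whose letters are pairs of an index and a sign. -/
def listWord {G : Type*} [Group G] (h : ι → G) (L : List (ι × Bool)) : G :=
  (L.map fun a => if a.2 then h a.1 else (h a.1)⁻¹).prod

lemma map_listWord {G G' : Type*} [Group G] [Group G'] (π : G →* G') (h : ι → G)
    (L : List (ι × Bool)) : π (listWord h L) = listWord (fun i => π (h i)) L := by
  simp only [listWord, map_list_prod, List.map_map]
  congr 2
  ext a
  simp [apply_ite π]

/-- The value of a word in `2 × 2` matrices, with adjugates in place of inverses. -/
def adjWord {R : Type*} [CommRing R] (A : ι → Matrix (Fin 2) (Fin 2) R) (L : List (ι × Bool)) :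
    Matrix (Fin 2) (Fin 2) R :=
  (L.map fun a => if a.2 then A a.1 else (A a.1).adjugate).prod

@[simp] lemma adjWord_nil {R : Type*} [CommRing R] (A : ι → Matrix (Fin 2) (Fin 2) R) :
    adjWord A [] = 1 := rfl

lemma adjWord_cons {R : Type*} [CommRing R] (A : ι → Matrix (Fin 2) (Fin 2) R) (x : ι × Bool)
    (L : List (ι × Bool)) :
    adjWord A (x :: L) = (if x.2 then A x.1 else (A x.1).adjugate) * adjWord A L := by
  simp only [adjWord, List.map_cons, List.prod_cons]

lemma map_adjWord {R S : Type*} [CommRing R] [CommRing S] (φ : R →+* S)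
    (A : ι → Matrix (Fin 2) (Fin 2) R) (L : List (ι × Bool)) :
    φ.mapMatrix (adjWord A L) = adjWord (fun i => φ.mapMatrix (A i)) L := by
  induction L with
  | nil => simp
  | cons x L ih =>
    rw [adjWord_cons, adjWord_cons, map_mul, ih, apply_ite φ.mapMatrix, RingHom.map_adjugate]

/-- The adjugate is the determinant times the inverse. Scalars are invisible in `PGL₂`, so inverses
may be traded for adjugates, which are polynomial in the entries. -/
lemma exists_adjWord_eq_smul {R : Type*} [CommRing R] (g : ι → GL (Fin 2) R)
    (L : List (ι × Bool)) :
    ∃ c : R, adjWord (fun i => (g i : Matrix (Fin 2) (Fin 2) R)) L =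
      c • (listWord g L : GL (Fin 2) R).1 := by
  induction L with
  | nil => exact ⟨1, by simp [listWord]⟩
  | cons x L ih =>
    obtain ⟨c, hc⟩ := ih
    obtain ⟨i, b⟩ := x
    have h1 : listWord g ((i, b) :: L) = (if b then g i else (g i)⁻¹) * listWord g L := by
      simp only [listWord, List.map_cons, List.prod_cons]
    rw [adjWord_cons, hc, h1]
    cases b with
    | true => exact ⟨c, by simp⟩
    | false =>
      refine ⟨(g i).1.det * c, ?_⟩
      have h2 : (g i).1.adjugate = (g i).1.det • ((g i)⁻¹ : GL (Fin 2) R).1 := by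
        rw [Matrix.coe_units_inv, Matrix.inv_def, smul_smul, Ring.mul_inverse_cancel, one_smul]
        exact (Matrix.isUnit_iff_isUnit_det _).1 (g i).isUnit
      simp [h2, smul_smul, mul_comm]

end ListWord

section RankOne

variable {ι F : Type*} [Field F]

/-- The rank one matrix `(1, a)ᵀ (1, a)`. -/
def rankOneMatrix (a : F) : Matrix (Fin 2) (Fin 2) F := Matrix.vecMulVec ![1, a] ![1, a]

/-- A singular tuple suffices to show that the word polynomial is nonzero. A letter is `v vᵀ` with
`v = (1, a)` or, for an adjugate, `v = (a, -1)`, so a product has rank one up to the dot products of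
neighbours. These are `1 + aᵢ aⱼ` for equal signs and `± (aᵢ - aⱼ)` for opposite signs; reducedness
gives `i ≠ j` in the second case. -/
lemma adjWord_rankOneMatrix {a : ι → F} (ha : Function.Injective a) (ha0 : ∀ i, a i ≠ 0)
    (ha1 : ∀ i j, 1 + a i * a j ≠ 0) (x : ι × Bool) (L : List (ι × Bool))
    (hL : (x :: L).IsChain fun a b => a.1 = b.1 → a.2 = b.2) :
    ∃ ρ : Fin 2 → F, ρ 1 ≠ 0 ∧ adjWord (fun i => rankOneMatrix (a i)) (x :: L) =
      Matrix.vecMulVec (if x.2 then ![1, a x.1] else ![a x.1, -1]) ρ := by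
  have hadj : ∀ i, (rankOneMatrix (a i)).adjugate =
      Matrix.vecMulVec ![a i, -1] ![a i, -1] := fun i => by
    ext k l
    fin_cases k <;> fin_cases l <;> simp [rankOneMatrix, Matrix.adjugate_fin_two, Matrix.vecMulVec]
  have hletter : ∀ x : ι × Bool,
      (if x.2 then rankOneMatrix (a x.1) else (rankOneMatrix (a x.1)).adjugate) =
        Matrix.vecMulVec (if x.2 then ![1, a x.1] else ![a x.1, -1])
          (if x.2 then ![1, a x.1] else ![a x.1, -1]) := by
    rintro ⟨i, b⟩
    cases b
    · simp [hadj]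
    · simp [rankOneMatrix]
  induction L generalizing x with
  | nil =>
    refine ⟨if x.2 then ![1, a x.1] else ![a x.1, -1], ?_, ?_⟩
    · split_ifs <;> simp [ha0]
    · rw [adjWord_cons, adjWord_nil, mul_one, hletter]
  | cons y L ih =>
    rw [List.isChain_cons_cons] at hL
    obtain ⟨ρ, hρ, h⟩ := ih y hL.2
    rw [adjWord_cons, h, hletter, Matrix.vecMulVec_mul_vecMulVec]
    refine ⟨_, ?_, rfl⟩
    simp only [Pi.smul_apply, smul_eq_mul]
    refine mul_ne_zero ?_ hρ
    obtain ⟨i, b⟩ := x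
    obtain ⟨j, b'⟩ := y
    have hij : b ≠ b' → a i - a j ≠ 0 := fun hb h0 =>
      hb (hL.1 (ha (sub_eq_zero.1 h0)))
    cases b <;> cases b' <;> simp [Matrix.dotProduct_cons] at hij ⊢
    · rw [add_comm]; exact ha1 i j
    · rwa [← sub_eq_add_neg]
    · intro h; exact hij (by linear_combination -h)
    · exact ha1 i j

end RankOne

section Counting

variable {ι F : Type*} [Field F]

lemma natDegree_adjWord_le (A : ι → Matrix (Fin 2) (Fin 2) (Polynomial F))
    (hA : ∀ i k l, (A i k l).natDegree ≤ 1) (L : List (ι × Bool)) (k l : Fin 2) :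
    (adjWord A L k l).natDegree ≤ L.length := by
  induction L generalizing k l with
  | nil => fin_cases k <;> fin_cases l <;> simp
  | cons x L ih =>
    have h1 : ∀ k l,
        ((if x.2 then A x.1 else (A x.1).adjugate : Matrix _ _ _) k l).natDegree ≤ 1 := by
      intro k l
      split_ifs
      · exact hA _ _ _
      · rw [Matrix.adjugate_fin_two]
        fin_cases k <;> fin_cases l <;> simp [hA]
    rw [adjWord_cons, Matrix.mul_apply, List.length_cons, add_comm]
    exact Polynomial.natDegree_sum_le_of_forall_le _ _ fun j _ =>
      Polynomial.natDegree_mul_le_of_le (h1 k j) (ih j l)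

/-- A polynomial function which does not vanish at `B` has few zeros on each line through `B`. -/
lemma card_adjWord_line_le [Fintype F] [DecidableEq F] (B D : ι → Matrix (Fin 2) (Fin 2) F)
    (L : List (ι × Bool)) (hB : adjWord B L 0 1 ≠ 0) :
    (Finset.univ.filter fun t : Fˣ => adjWord (fun i => B i + (t : F) • D i) L 0 1 = 0).card ≤
      L.length := by
  set A : ι → Matrix (Fin 2) (Fin 2) (Polynomial F) := fun i =>
    Matrix.of fun k l => Polynomial.C (B i k l) + Polynomial.X * Polynomial.C (D i k l) with hA
  set P := adjWord A L 0 1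
  have heval : ∀ t : F, P.eval t = adjWord (fun i => B i + t • D i) L 0 1 := by
    intro t
    have h1 := congrFun₂ (map_adjWord (Polynomial.evalRingHom t) A L) 0 1
    simp only [RingHom.mapMatrix_apply, Matrix.map_apply, Polynomial.coe_evalRingHom] at h1
    rw [h1]
    congr 2
    ext i k l
    simp only [hA, Matrix.map_apply, Matrix.of_apply, Polynomial.eval_add, Polynomial.eval_C,
      Polynomial.eval_mul, Polynomial.eval_X, Matrix.add_apply, Matrix.smul_apply, smul_eq_mul]
  have hP : P ≠ 0 := by
    intro h0
    have := heval 0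
    simp only [h0, Polynomial.eval_zero, zero_smul, add_zero] at this
    exact hB this.symm
  have hdeg : P.natDegree ≤ L.length := by
    refine natDegree_adjWord_le A (fun i k l => ?_) L 0 1
    simp only [hA, Matrix.of_apply]
    refine Polynomial.natDegree_add_le_of_degree_le (by simp) ?_
    exact (Polynomial.natDegree_mul_C_le _ _).trans Polynomial.natDegree_X_le
  refine le_trans ?_ ((Polynomial.card_roots' P).trans hdeg)
  refine le_trans ?_ (Multiset.toFinset_card_le _)
  refine Finset.card_le_card_of_injOn (fun t : Fˣ => (t : F)) ?_ (fun _ _ _ _ h => Units.ext h)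
  intro t ht
  simp only [Finset.coe_filter, Finset.mem_univ, true_and, Set.mem_ofPred_eq] at ht
  simp [hP, heval, ht]

/-- A Schwartz–Zippel bound by double counting pairs `(t, D)`: for each `t ≠ 0` the map `D ↦ B + t
D` permutes the tuples, while each line through `B` contains at most `L.length` zeros. -/
lemma card_adjWord_eq_zero_le [Fintype F] [DecidableEq F] [Fintype ι] [DecidableEq ι]
    (B : ι → Matrix (Fin 2) (Fin 2) F) (L : List (ι × Bool)) (hB : adjWord B L 0 1 ≠ 0) :
    (Fintype.card F - 1) * (Finset.univ.filter fun A : ι → Matrix (Fin 2) (Fin 2) F =>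
      adjWord A L 0 1 = 0).card ≤ L.length * Fintype.card (ι → Matrix (Fin 2) (Fin 2) F) := by
  have h1 : ∀ t : Fˣ, (Finset.univ.filter fun D : ι → Matrix (Fin 2) (Fin 2) F =>
      adjWord (fun i => B i + (t : F) • D i) L 0 1 = 0).card =
      (Finset.univ.filter fun A : ι → Matrix (Fin 2) (Fin 2) F => adjWord A L 0 1 = 0).card := by
    intro t
    refine Finset.card_bij' (fun D _ i => B i + (t : F) • D i)
      (fun A _ i => ((t⁻¹ : Fˣ) : F) • (A i - B i)) ?_ ?_ ?_ ?_
    · intro D hD; simpa using hD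
    · intro A hA; simpa [smul_smul] using hA
    · intro D _; ext i : 1; simp [smul_smul]
    · intro D _; ext i : 1; simp [smul_smul]
  calc _ = ∑ t : Fˣ, (Finset.univ.filter fun D : ι → Matrix (Fin 2) (Fin 2) F =>
      adjWord (fun i => B i + (t : F) • D i) L 0 1 = 0).card := by
        simp only [h1, Finset.sum_const, Finset.card_univ, Fintype.card_units, smul_eq_mul]
    _ = ∑ D : ι → Matrix (Fin 2) (Fin 2) F, (Finset.univ.filter fun t : Fˣ =>
      adjWord (fun i => B i + (t : F) • D i) L 0 1 = 0).card := by
        simp only [Finset.card_filter]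
        exact Finset.sum_comm
    _ ≤ _ := by
        refine (Finset.sum_le_card_nsmul _ _ L.length fun D _ => ?_).trans ?_
        · exact card_adjWord_line_le B D L hB
        · rw [smul_eq_mul, mul_comm, Finset.card_univ]

lemma card_GL_le_card_PGL [Fintype F] :
    Nat.card (GL (Fin 2) F) ≤ Nat.card (PGL(2, F)) * (Fintype.card F - 1) := by
  classical
  rw [← Fintype.card_units, ← Nat.card_eq_fintype_card, ← Nat.card_prod]
  have : Finite (PGL(2, F)) := Finite.of_surjective _ Matrix.ProjGenLinGroup.mk_surjective
  refine Nat.card_le_card_of_surjective (fun x : PGL(2, F) × Fˣ =>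
    Function.surjInv Matrix.ProjGenLinGroup.mk_surjective x.1 * .scalar (Fin 2) x.2) ?_
  intro g
  obtain ⟨u, hu⟩ := Matrix.ProjGenLinGroup.mk_eq_mk_iff.1
    (Function.surjInv_eq Matrix.ProjGenLinGroup.mk_surjective (Matrix.ProjGenLinGroup.mk g))
  exact ⟨(Matrix.ProjGenLinGroup.mk g, u), hu⟩

lemma adjWord_eq_zero_of_listWord_eq_one (g : ι → GL (Fin 2) F) (L : List (ι × Bool))
    (hL : listWord (fun i => Matrix.ProjGenLinGroup.mk (g i)) L = 1) :
    adjWord (fun i => (g i : Matrix (Fin 2) (Fin 2) F)) L 0 1 = 0 := by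
  rw [← map_listWord, Matrix.ProjGenLinGroup.mk_eq_one,
    Matrix.GeneralLinearGroup.center_eq_range_scalar] at hL
  obtain ⟨u, hu⟩ := hL
  obtain ⟨c, hc⟩ := exists_adjWord_eq_smul g L
  rw [hc, ← hu]
  simp

/-- Each coordinate has `|F| - 1` lifts to `GL₂`, and every lift of a tuple with trivial word is a
zero of the polynomial. -/
lemma card_listWord_eq_one_mul_le [Fintype F] [DecidableEq F] [Fintype ι] [DecidableEq ι]
    [Fintype (PGL(2, F))] [DecidableEq (PGL(2, F))] (L : List (ι × Bool)) :
    (Finset.univ.filter fun h : ι → PGL(2, F) => listWord h L = 1).card *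
      (Fintype.card F - 1) ^ Fintype.card ι ≤
    (Finset.univ.filter fun A : ι → Matrix (Fin 2) (Fin 2) F => adjWord A L 0 1 = 0).card := by
  rw [← Fintype.card_units, ← Fintype.card_fun, ← Finset.card_univ (α := ι → Fˣ),
    ← Finset.card_product]
  set out : PGL(2, F) → GL (Fin 2) F := Function.surjInv Matrix.ProjGenLinGroup.mk_surjective
  have hout : ∀ x u, Matrix.ProjGenLinGroup.mk (out x * .scalar (Fin 2) u) = x := fun x u => by
    rw [map_mul, Matrix.ProjGenLinGroup.mk_scalar, mul_one]
    exact Function.surjInv_eq Matrix.ProjGenLinGroup.mk_surjective x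
  refine Finset.card_le_card_of_injOn
    (fun x i => ((out (x.1 i) * .scalar (Fin 2) (x.2 i) : GL (Fin 2) F) :
      Matrix (Fin 2) (Fin 2) F)) ?_ ?_
  · rintro ⟨h, c⟩ hx
    simp only [Finset.coe_product, Set.mem_prod, Finset.coe_filter, Finset.mem_univ, true_and,
      Set.mem_ofPred_eq] at hx ⊢
    apply adjWord_eq_zero_of_listWord_eq_one
    simpa only [hout] using hx.1
  · rintro ⟨h, c⟩ - ⟨h', c'⟩ - heq
    have heq' : ∀ i, out (h i) * .scalar (Fin 2) (c i) = out (h' i) * .scalar (Fin 2) (c' i) :=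
      fun i => Units.ext (congrFun heq i)
    have h1 : h = h' := by
      ext i : 1
      rw [← hout (h i) (c i), heq', hout]
    subst h1
    refine Prod.ext rfl ?_
    ext i : 1
    have h2 := mul_left_cancel (heq' i)
    have h3 := congrArg (fun g : GL (Fin 2) F => g.1 0 0) h2
    exact Units.ext (by simpa using h3)

/-- Restricting to invertible tuples costs at most a factor `2`: the proportion of invertible
matrices is at least `1 - 2 / p`, and Bernoulli's inequality gives `(1 - 2 / p) ^ M ≥ 1 - 2 M / p ≥
1 / 2`. -/
lemma pow_le_two_mul_card_GL_pow {p : ℕ} [Fact p.Prime] {M : ℕ} (hM : 4 * M ≤ p) :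
    (p ^ 4) ^ M ≤ 2 * Nat.card (GL (Fin 2) (ZMod p)) ^ M := by
  have hp0 : 2 ≤ p := (Fact.out : p.Prime).two_le
  have hp : (2 : ℝ) ≤ p := by exact_mod_cast hp0
  have hM' : (4 : ℝ) * M ≤ p := by exact_mod_cast hM
  have hcard : (Nat.card (GL (Fin 2) (ZMod p)) : ℝ) = ((p : ℝ) ^ 2 - 1) * ((p : ℝ) ^ 2 - p) := by
    rw [Matrix.card_GL_field, Fin.prod_univ_two, ZMod.card]
    have h1 : p ^ ((0 : Fin 2) : ℕ) ≤ p ^ 2 := Nat.pow_le_pow_right (by lia) (by simp)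
    have h2 : p ^ ((1 : Fin 2) : ℕ) ≤ p ^ 2 := Nat.pow_le_pow_right (by lia) (by simp)
    rw [Nat.cast_mul, Nat.cast_sub h1, Nat.cast_sub h2]
    simp
  have h1 : (p : ℝ) ^ 4 * (1 + -(2 / p)) ≤ Nat.card (GL (Fin 2) (ZMod p)) := by
    rw [hcard]
    have : (p : ℝ) ^ 4 * (1 + -(2 / p)) = p ^ 4 - 2 * p ^ 3 := by field_simp; ring
    rw [this]
    nlinarith [pow_pos (by linarith : (0 : ℝ) < p) 2]
  have h2 : (2 : ℝ) / p ≤ 1 := by rw [div_le_one (by linarith)]; exact hp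
  have h3 : (1 : ℝ) / 2 ≤ (1 + -(2 / p)) ^ M := by
    refine le_trans ?_ (one_add_mul_le_pow (by linarith) M)
    have : (M : ℝ) * (2 / p) ≤ 1 / 2 := by
      rw [mul_div_assoc', div_le_iff₀ (by linarith)]
      linarith
    linarith
  have h4 : ((p : ℝ) ^ 4) ^ M * (1 + -(2 / p)) ^ M ≤ (Nat.card (GL (Fin 2) (ZMod p)) : ℝ) ^ M := by
    rw [← mul_pow]
    exact pow_le_pow_left₀ (mul_nonneg (by positivity) (by linarith)) h1 M
  have h5 : ((p : ℝ) ^ 4) ^ M ≤ 2 * (Nat.card (GL (Fin 2) (ZMod p)) : ℝ) ^ M := by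
    have : ((p : ℝ) ^ 4) ^ M * (1 / 2) ≤ ((p : ℝ) ^ 4) ^ M * (1 + -(2 / p)) ^ M :=
      mul_le_mul_of_nonneg_left h3 (by positivity)
    linarith
  exact_mod_cast h5

lemma exists_injective_one_add_mul_ne_zero [Fintype ι] {p : ℕ} [Fact p.Prime]
    (hp : Fintype.card ι ^ 2 + 1 < p) :
    ∃ a : ι → ZMod p, Function.Injective a ∧ (∀ i, a i ≠ 0) ∧ ∀ i j, 1 + a i * a j ≠ 0 := by
  set e := Fintype.equivFin ι
  have hlt : ∀ i, (e i : ℕ) + 1 ≤ Fintype.card ι := fun i => (e i).isLt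
  have hM : Fintype.card ι ≤ Fintype.card ι ^ 2 := Nat.le_self_pow two_ne_zero _
  have hne : ∀ k : ℕ, 0 < k → k < p → (k : ZMod p) ≠ 0 := fun k h0 h1 h2 =>
    absurd (Nat.le_of_dvd h0 ((ZMod.natCast_eq_zero_iff k p).1 h2)) (by lia)
  -- The residues `1, …, |ι|`: all the integers that must not vanish are positive and at most `|ι| ^
  -- 2 + 1 < p`.
  refine ⟨fun i => ((e i + 1 : ℕ) : ZMod p), fun i j hij => ?_, fun i => ?_, fun i j => ?_⟩
  · have h1 := (ZMod.natCast_eq_natCast_iff' _ _ _).1 hij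
    rw [Nat.mod_eq_of_lt (by have := hlt i; lia), Nat.mod_eq_of_lt (by have := hlt j; lia)] at h1
    exact e.injective (Fin.ext (by lia))
  · exact hne _ (Nat.succ_pos _) (by have := hlt i; lia)
  · have h1 : (e i + 1 : ℕ) * (e j + 1 : ℕ) ≤ Fintype.card ι ^ 2 := by
      rw [sq]; exact Nat.mul_le_mul (hlt i) (hlt j)
    have := hne (1 + (e i + 1 : ℕ) * (e j + 1 : ℕ)) (by positivity) (by lia)
    push_cast at this ⊢
    exact this

/-- A reduced word of length `m` is trivial on a proportion at most `2 m / (p - 1)` of all tuples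
in `PGL₂(ℤ/pℤ)`. -/
lemma card_listWord_eq_one_le {p : ℕ} [Fact p.Prime] [Fintype ι] [DecidableEq ι]
    [Fintype (PGL(2, ZMod p))] [DecidableEq (PGL(2, ZMod p))] (x : ι × Bool) (L : List (ι × Bool))
    (hL : (x :: L).IsChain fun a b => a.1 = b.1 → a.2 = b.2)
    (hp : Fintype.card ι ^ 2 + 1 < p) (hp' : 4 * Fintype.card ι ≤ p) :
    (Finset.univ.filter fun h : ι → PGL(2, ZMod p) => listWord h (x :: L) = 1).card * (p - 1) ≤
      2 * (x :: L).length * Fintype.card (ι → PGL(2, ZMod p)) := by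
  obtain ⟨a, ha, ha0, ha1⟩ := exists_injective_one_add_mul_ne_zero hp
  set bad := (Finset.univ.filter fun h : ι → PGL(2, ZMod p) => listWord h (x :: L) = 1).card
  have hB : adjWord (fun i => rankOneMatrix (a i)) (x :: L) 0 1 ≠ 0 := by
    obtain ⟨ρ, hρ, h⟩ := adjWord_rankOneMatrix ha ha0 ha1 x L hL
    rw [h, Matrix.vecMulVec_apply]
    refine mul_ne_zero ?_ hρ
    split_ifs <;> simp [ha0]
  have h1 := card_listWord_eq_one_mul_le (F := ZMod p) (x :: L)
  have h2 := card_adjWord_eq_zero_le _ _ hB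
  have h3 := Nat.pow_le_pow_left (card_GL_le_card_PGL (F := ZMod p)) (Fintype.card ι)
  have h4 := pow_le_two_mul_card_GL_pow (p := p) hp'
  have h5 : Fintype.card (ι → Matrix (Fin 2) (Fin 2) (ZMod p)) = (p ^ 4) ^ Fintype.card ι := by
    have : Fintype.card (Matrix (Fin 2) (Fin 2) (ZMod p)) = p ^ 4 := by
      rw [← Fintype.card_congr (Matrix.of (m := Fin 2) (n := Fin 2) (α := ZMod p))]
      simp only [Fintype.card_fun, Fintype.card_fin, ZMod.card]
      ring
    rw [Fintype.card_fun, this]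
  rw [h5] at h2
  rw [ZMod.card] at h1 h2 h3
  rw [Nat.card_eq_fintype_card (α := PGL(2, ZMod p)), mul_pow] at h3
  rw [Fintype.card_fun]
  have hp1 : 0 < p - 1 := by have := (Fact.out : p.Prime).two_le; lia
  refine le_of_mul_le_mul_right (a := (p - 1) ^ Fintype.card ι) ?_ (pow_pos hp1 _)
  calc bad * (p - 1) * (p - 1) ^ Fintype.card ι
      = (p - 1) * (bad * (p - 1) ^ Fintype.card ι) := by ring
    _ ≤ (x :: L).length * (p ^ 4) ^ Fintype.card ι := (Nat.mul_le_mul_left _ h1).trans h2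
    _ ≤ (x :: L).length * (2 * (Fintype.card PGL(2, ZMod p) ^ Fintype.card ι *
          (p - 1) ^ Fintype.card ι)) :=
        Nat.mul_le_mul_left _ (h4.trans (Nat.mul_le_mul_left _ h3))
    _ = _ := by ring

end Counting

/-! ### Trace method: alternating words and averages of unitaries -/

section AlternatingWord

variable {G α : Type*} [Group G] (h : α → G)

/-- The sign pattern `-, +, -, +, …`. -/
def altSign (m : ℕ) : Fin m → Bool := fun k => decide ((k : ℕ) % 2 = 1)

lemma signedWord_altSign_cons_cons {n : ℕ} (a b : α) (f : Fin (2 * n) → α) :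
    signedWord h (altSign (2 * n + 1 + 1)) (Fin.cons a (Fin.cons b f)) =
      (h a)⁻¹ * (h b * signedWord h (altSign (2 * n)) f) := by
  rw [signedWord_succ, Fin.tail_cons, signedWord_succ, Fin.tail_cons]
  have : Fin.tail (Fin.tail (altSign (2 * n + 1 + 1))) = altSign (2 * n) := by
    ext k
    simp [altSign, Fin.tail, Nat.add_assoc]
  rw [this]
  simp [altSign, Fin.tail]

/-- Since the length is even, reversal flips the parity of each position, hence its sign. -/
lemma signedWord_altSign_rev (n : ℕ) (f : Fin (2 * n) → α) :
    signedWord h (altSign (2 * n)) (f ∘ Fin.rev) = (signedWord h (altSign (2 * n)) f)⁻¹ := by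
  rw [signedWord, signedWord, List.prod_inv_reverse, List.map_ofFn]
  congr 1
  refine List.ext_getElem (by simp) fun i h1 h2 => ?_
  simp only [List.length_ofFn] at h1
  have h3 : (2 * n - 1 - i) % 2 = 1 ↔ ¬ i % 2 = 1 := by lia
  have h4 : Fin.rev (⟨i, h1⟩ : Fin (2 * n)) = ⟨2 * n - 1 - i, by lia⟩ := by
    ext; simp [Fin.val_rev]; lia
  by_cases h5 : i % 2 = 1 <;> simp [altSign, h3, h4, h5]

lemma signedWord_altSign_append (n n' : ℕ) (f : Fin (2 * n) → α) (f' : Fin n' → α) :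
    signedWord h (altSign (2 * n + n')) (Fin.append f f') =
      signedWord h (altSign (2 * n)) f * signedWord h (altSign n') f' := by
  rw [signedWord, signedWord, signedWord, ← List.prod_append, ← List.ofFn_fin_append]
  congr 2
  ext k
  cases k using Fin.addCases with
  | left k => simp [altSign]
  | right k => simp [altSign]

variable [DecidableEq G] [Fintype α]

/-- The number of alternating words of length `m` with value `g`. -/
def altCount (m : ℕ) (g : G) : ℕ :=
  (Finset.univ.filter fun f : Fin m → α => signedWord h (altSign m) f = g).card

lemma altCount_inv (n : ℕ) (g : G) : altCount h (2 * n) g⁻¹ = altCount h (2 * n) g := by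
  refine Finset.card_bij' (fun f _ => f ∘ Fin.rev) (fun f _ => f ∘ Fin.rev) ?_ ?_ ?_ ?_
  · intro f hf
    simpa [signedWord_altSign_rev, inv_eq_iff_eq_inv] using hf
  · intro f hf
    simpa [signedWord_altSign_rev, inv_eq_iff_eq_inv] using hf
  · intro f _; ext; simp
  · intro f _; ext; simp

lemma sum_altCount_mul {R : Type*} [AddCommMonoid R] [Fintype G] (m : ℕ) (φ : G → R) :
    ∑ g, altCount h m g • φ g = ∑ f : Fin m → α, φ (signedWord h (altSign m) f) := by
  rw [← Finset.sum_fiberwise Finset.univ (signedWord h (altSign m))]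
  refine Finset.sum_congr rfl fun g _ => ?_
  rw [altCount, ← Finset.sum_const]
  refine Finset.sum_congr rfl fun f hf => ?_
  rw [(Finset.mem_filter.1 hf).2]

/-- Cut a word of length `4 n` in the middle: it is trivial when its halves have inverse values, and
`altCount_inv` makes the two counts equal. -/
lemma sum_altCount_sq [Fintype G] (n : ℕ) :
    ∑ g, altCount h (2 * n) g ^ 2 = altCount h (2 * n + 2 * n) 1 := by
  have h1 : altCount h (2 * n + 2 * n) 1 =
      ∑ f : Fin (2 * n) → α, altCount h (2 * n) (signedWord h (altSign (2 * n)) f) := by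
    rw [altCount, Finset.card_filter, ← (Fin.appendEquiv (2 * n) (2 * n)).sum_comp,
      Fintype.sum_prod_type]
    refine Finset.sum_congr rfl fun f _ => ?_
    rw [← altCount_inv, altCount, Finset.card_filter]
    refine Finset.sum_congr rfl fun f' _ => ?_
    simp only [Fin.appendEquiv, Equiv.coe_fn_mk, signedWord_altSign_append]
    simp only [mul_eq_one_iff_inv_eq, eq_comm (b := signedWord h (altSign (2 * n)) f')]
  rw [h1, ← sum_altCount_mul]
  exact Finset.sum_congr rfl fun g _ => by rw [sq, smul_eq_mul]

end AlternatingWord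

section Average

variable {A : Type*} [Ring A] [Algebra ℂ A] {G : Type*} [Group G] (U : G →* A)
  {α : Type*} [Fintype α]

/-- The average of `U` over the points of a family. -/
def familyAverage (h : α → G) : A :=
  (Fintype.card α : ℂ)⁻¹ • ∑ j, U (h j)

lemma star_familyAverage [StarRing A] [StarModule ℂ A] (hU : ∀ g, star (U g) = U g⁻¹) (h : α → G) :
    star (familyAverage U h) = familyAverage U fun j => (h j)⁻¹ := by
  simp [familyAverage, star_smul, star_sum, hU]

lemma star_mul_familyAverage_pow (h : α → G) [StarRing A] [StarModule ℂ A]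
    (hU : ∀ g, star (U g) = U g⁻¹) (n : ℕ) :
    (star (familyAverage U h) * familyAverage U h) ^ n =
      ((Fintype.card α : ℂ) ^ (2 * n))⁻¹ •
        ∑ f : Fin (2 * n) → α, U (signedWord h (altSign (2 * n)) f) := by
  induction n with
  | zero => simp [signedWord]
  | succ n ih =>
    have hcons : ∀ (m : ℕ) (φ : (Fin (m + 1) → α) → A),
        ∑ f : Fin (m + 1) → α, φ f = ∑ a, ∑ f : Fin m → α, φ (Fin.cons a f) := fun m φ => by
      rw [← (Fin.consEquiv fun _ => α).sum_comp, Fintype.sum_prod_type]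
      rfl
    rw [pow_succ', ih]
    change _ = ((Fintype.card α : ℂ) ^ (2 * n + 1 + 1))⁻¹ •
      ∑ f : Fin (2 * n + 1 + 1) → α, U (signedWord h (altSign (2 * n + 1 + 1)) f)
    rw [hcons]
    simp only [hcons, signedWord_altSign_cons_cons, map_mul]
    rw [star_familyAverage U hU, familyAverage, familyAverage]
    simp only [smul_mul_smul_comm, ← Finset.mul_sum]
    simp only [← Finset.sum_mul, mul_assoc]
    congr 1
    rw [pow_succ, pow_succ, mul_inv, mul_inv]
    ring

variable [Fintype G]

lemma mul_familyAverage_id (g : G) : U g * familyAverage U id = familyAverage U id := by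
  simp only [familyAverage, mul_smul_comm, Finset.mul_sum, id, ← map_mul]
  exact congrArg _ (Equiv.sum_comp (Equiv.mulLeft g) fun x => U x)

lemma familyAverage_id_mul (g : G) : familyAverage U id * U g = familyAverage U id := by
  simp only [familyAverage, smul_mul_assoc, Finset.sum_mul, id, ← map_mul]
  exact congrArg _ (Equiv.sum_comp (Equiv.mulRight g) fun x => U x)

variable [Nonempty α] (h : α → G)

lemma familyAverage_mul_id : familyAverage U h * familyAverage U id = familyAverage U id := by
  rw [familyAverage, smul_mul_assoc, Finset.sum_mul]
  simp only [mul_familyAverage_id, Finset.sum_const, Finset.card_univ]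
  rw [← Nat.cast_smul_eq_nsmul ℂ, smul_smul, inv_mul_cancel₀ (by simp), one_smul]

lemma id_mul_familyAverage : familyAverage U id * familyAverage U h = familyAverage U id := by
  rw [show familyAverage U h = (Fintype.card α : ℂ)⁻¹ • ∑ j, U (h j) from rfl, mul_smul_comm,
    Finset.mul_sum]
  simp only [familyAverage_id_mul, Finset.sum_const, Finset.card_univ]
  rw [← Nat.cast_smul_eq_nsmul ℂ, smul_smul, inv_mul_cancel₀ (by simp), one_smul]

lemma star_familyAverage_id [StarRing A] [StarModule ℂ A] (hU : ∀ g, star (U g) = U g⁻¹) :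
    star (familyAverage U id) = familyAverage U id := by
  rw [star_familyAverage U hU, familyAverage, familyAverage]
  congr 1
  exact Equiv.sum_comp (Equiv.inv G) fun x => U x

lemma star_mul_self_familyAverage_sub [StarRing A] [StarModule ℂ A]
    (hU : ∀ g, star (U g) = U g⁻¹) :
    star (familyAverage U h - familyAverage U id) * (familyAverage U h - familyAverage U id) =
      star (familyAverage U h) * familyAverage U h - familyAverage U id := by
  have h1 := familyAverage_mul_id U (fun j => (h j)⁻¹)
  rw [← star_familyAverage U hU] at h1
  rw [star_sub, star_familyAverage_id U hU, sub_mul, mul_sub, mul_sub, h1,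
    id_mul_familyAverage, id_mul_familyAverage]
  abel

lemma sub_pow_of_mul_eq {R : Type*} [Ring R] {Q P : R} (h1 : Q * P = P) (h2 : P * Q = P)
    (h3 : P * P = P) (n : ℕ) : (Q - P) ^ (n + 1) = Q ^ (n + 1) - P := by
  have h4 : ∀ n : ℕ, Q ^ n * P = P := fun n => by
    induction n with
    | zero => simp
    | succ n ih => rw [pow_succ, mul_assoc, h1, ih]
  induction n with
  | zero => simp
  | succ n ih => rw [pow_succ, ih, sub_mul, mul_sub, mul_sub, h2, h3, h4, pow_succ Q (n + 1)]; abel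

end Average


section Spectral

variable {A : Type*} [NormedRing A] [StarRing A] [CStarRing A] [NormedAlgebra ℂ A] [StarModule ℂ A]
  {G : Type*} [Group G] [Fintype G] (U : G →* A) {α : Type*} [Fintype α] [Nonempty α] (h : α → G)

/-- A bound for the distance of an average of unitaries to the projection on the fixed vectors by
the number of trivial alternating words. -/
lemma norm_familyAverage_sub_pow_le [DecidableEq G]
    (hU : ∀ g, star (U g) = U g⁻¹) (hU1 : ∀ g, ‖U g‖ ≤ 1) (s n : ℕ) (hn : n = 2 ^ s) :
    ‖familyAverage U h - familyAverage U id‖ ^ (4 * n) ≤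
      Fintype.card G * altCount h (2 * n + 2 * n) 1 / (Fintype.card α : ℝ) ^ (4 * n) - 1 := by
  set T := familyAverage U h
  set P := familyAverage U (id : G → G) with hP
  set c : G → ℝ := fun g => altCount h (2 * n) g / (Fintype.card α : ℝ) ^ (2 * n) with hc
  set N : ℝ := (Fintype.card G : ℝ) with hN
  have hN0 : N ≠ 0 := by simp [hN]
  have hα : (Fintype.card α : ℝ) ≠ 0 := by simp
  -- `c` is the law of the alternating random walk after `2 n` steps; subtracting `P` subtracts the
  -- uniform law.
  have h1 : (star (T - P) * (T - P)) ^ n = ∑ g, ((c g - N⁻¹ : ℝ) : ℂ) • U g := by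
    obtain ⟨n', rfl⟩ : ∃ n', n = n' + 1 := ⟨n - 1, by have := Nat.two_pow_pos s; lia⟩
    have hQP : star T * T * P = P := by
      rw [mul_assoc, familyAverage_mul_id, star_familyAverage U hU, familyAverage_mul_id]
    have hPQ : P * (star T * T) = P := by
      rw [← mul_assoc, star_familyAverage U hU, id_mul_familyAverage, id_mul_familyAverage]
    rw [star_mul_self_familyAverage_sub U h hU, sub_pow_of_mul_eq hQP hPQ
      (familyAverage_mul_id U _), star_mul_familyAverage_pow U h hU, ← sum_altCount_mul h _
        (fun g => U g), hP, familyAverage, Finset.smul_sum, Finset.smul_sum,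
      ← Finset.sum_sub_distrib]
    refine Finset.sum_congr rfl fun g _ => ?_
    rw [← Nat.cast_smul_eq_nsmul ℂ, smul_smul, id, ← sub_smul]
    congr 1
    simp only [hc, hN]
    push_cast
    rw [div_eq_inv_mul]
  have hsum : ∑ g, c g = 1 := by
    have := sum_altCount_mul h (2 * n) (fun _ => (1 : ℝ))
    simp only [nsmul_eq_mul, mul_one, Finset.sum_const, Finset.card_univ, Fintype.card_fun,
      Fintype.card_fin, Nat.cast_pow] at this
    rw [hc, ← Finset.sum_div, this]
    exact div_self (pow_ne_zero _ hα)
  have hsq : ∑ g, c g ^ 2 = altCount h (2 * n + 2 * n) 1 / (Fintype.card α : ℝ) ^ (4 * n) := by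
    rw [← sum_altCount_sq, Nat.cast_sum, Finset.sum_div]
    refine Finset.sum_congr rfl fun g _ => ?_
    simp only [hc, div_pow, Nat.cast_pow]
    rw [← pow_mul]
    congr 2
    ring
  have h2 : ‖T - P‖ ^ (2 * n) ≤ ∑ g, |c g - N⁻¹| := by
    have h3 : ‖T - P‖ ^ (2 * n) = ‖(star (T - P) * (T - P)) ^ n‖ := by
      rw [pow_mul, sq, ← CStarRing.norm_star_mul_self, hn]
      -- The exponent is a power of two so that the C⋆-identity can be iterated.
      exact ((IsSelfAdjoint.star_mul_self (T - P)).norm_pow_two_pow s).symm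
    rw [h3, h1]
    refine norm_sum_le_of_le _ fun g _ => ?_
    rw [norm_smul, Complex.norm_real, Real.norm_eq_abs]
    exact mul_le_of_le_one_right (abs_nonneg _) (hU1 g)
  calc ‖T - P‖ ^ (4 * n) = (‖T - P‖ ^ (2 * n)) ^ 2 := by rw [← pow_mul]; congr 1; ring
    _ ≤ (∑ g, |c g - N⁻¹|) ^ 2 := pow_le_pow_left₀ (by positivity) h2 2
    -- Cauchy–Schwarz; the `ℓ²` norm of `c` is then a return count, whatever the representation.
    _ ≤ N * ∑ g, |c g - N⁻¹| ^ 2 := by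
        simpa [hN] using sq_sum_le_card_mul_sum_sq (s := Finset.univ) (f := fun g => |c g - N⁻¹|)
    _ = N * (∑ g, c g ^ 2 - 2 * N⁻¹ * ∑ g, c g + ∑ _g : G, N⁻¹ ^ 2) := by
        rw [Finset.mul_sum Finset.univ c (2 * N⁻¹), ← Finset.sum_sub_distrib,
          ← Finset.sum_add_distrib]
        congr 1
        refine Finset.sum_congr rfl fun g _ => ?_
        rw [sq_abs]; ring
    _ = _ := by
        rw [hsum, hsq, Finset.sum_const, Finset.card_univ, nsmul_eq_mul]
        field_simp
        ring

end Spectral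

instance (p : Nat.Primes) : Fintype (PGLTwo p) := Fintype.ofFinite _

/-- In every unitary representation, the average of the representation over the family `h` is close
to the projection on the space of fixed vectors. -/
def HasSmallAverages {G α : Type} [Group G] [Fintype G] [Fintype α] (h : α → G) (ε : ℝ) : Prop :=
  ∀ (A : Type) [NormedRing A] [StarRing A] [CStarRing A] [NormedAlgebra ℂ A] [StarModule ℂ A]
    (U : G →* A), (∀ g, star (U g) = U g⁻¹) → (∀ g, ‖U g‖ ≤ 1) →
    ‖familyAverage U h - familyAverage U id‖ ≤ ε

/-- No nontrivial reduced word of length at most `ℓ` in the family `h` is trivial. -/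
def HasLargeGirth {G ι : Type*} [Group G] (h : ι → G) (ℓ : ℕ) : Prop :=
  ∀ L : List (ι × Bool), L ≠ [] → L.length ≤ ℓ →
    (L.IsChain fun a b => a.1 = b.1 → a.2 = b.2) → listWord h L ≠ 1

/-! ### Random families with large girth and small averages -/

section Girth

variable {ι : Type} [Fintype ι] [DecidableEq ι]

open Classical in
-- Union bound over at most `ℓ (2 |ι|) ^ ℓ` reduced words, each trivial with probability at most `2
-- ℓ / (p - 1)`.
lemma card_not_hasLargeGirth_le {p : ℕ} [Fact p.Prime] [Fintype (PGL(2, ZMod p))] [Nonempty ι]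
    (ℓ : ℕ) (hp : Fintype.card ι ^ 2 + 1 < p) (hp' : 4 * Fintype.card ι ≤ p) :
    (Finset.univ.filter fun h : ι → PGL(2, ZMod p) => ¬ HasLargeGirth h ℓ).card * (p - 1) ≤
      2 * ℓ ^ 2 * (2 * Fintype.card ι) ^ ℓ * Fintype.card (ι → PGL(2, ZMod p)) := by
  set good : (m : ℕ) → Finset (Fin (m + 1) → ι × Bool) := fun m =>
    Finset.univ.filter fun w => (List.ofFn w).IsChain fun a b => a.1 = b.1 → a.2 = b.2
  have hsub : (Finset.univ.filter fun h : ι → PGL(2, ZMod p) => ¬ HasLargeGirth h ℓ) ⊆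
      (Finset.range ℓ).biUnion fun m => (good m).biUnion fun w =>
        Finset.univ.filter fun h : ι → PGL(2, ZMod p) => listWord h (List.ofFn w) = 1 := by
    intro h hh
    simp only [Finset.mem_filter, Finset.mem_univ, true_and, HasLargeGirth, not_forall,
      ne_eq, not_not] at hh
    obtain ⟨L, hL0, hLℓ, hL, h1⟩ := hh
    obtain ⟨m, hm⟩ : ∃ m, L.length = m + 1 :=
      ⟨L.length - 1, by have := List.length_pos_iff.2 hL0; lia⟩
    obtain ⟨w, rfl⟩ : ∃ w : Fin (m + 1) → ι × Bool, L = List.ofFn w :=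
      ⟨fun i => L.get (i.cast hm.symm), by
        refine List.ext_getElem (by simp [hm]) fun i h1 h2 => by simp only [List.getElem_ofFn]; rfl⟩
    simp only [Finset.mem_biUnion, Finset.mem_range, Finset.mem_filter, Finset.mem_univ, true_and,
      good]
    exact ⟨m, by lia, w, hL, h1⟩
  have hword : ∀ m ∈ Finset.range ℓ, ∀ w ∈ good m,
      (Finset.univ.filter fun h : ι → PGL(2, ZMod p) => listWord h (List.ofFn w) = 1).card *
        (p - 1) ≤ 2 * ℓ * Fintype.card (ι → PGL(2, ZMod p)) := by
    intro m hm w hw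
    simp only [Finset.mem_filter, Finset.mem_univ, true_and, good, Finset.mem_range] at hw hm
    rw [List.ofFn_succ] at hw ⊢
    refine (card_listWord_eq_one_le _ _ hw hp hp').trans ?_
    refine Nat.mul_le_mul_right _ (Nat.mul_le_mul_left _ ?_)
    simpa using hm
  calc _ ≤ (∑ m ∈ Finset.range ℓ, ∑ w ∈ good m, (Finset.univ.filter
        fun h : ι → PGL(2, ZMod p) => listWord h (List.ofFn w) = 1).card) * (p - 1) := by
        refine Nat.mul_le_mul_right _ ((Finset.card_le_card hsub).trans ?_)
        refine Finset.card_biUnion_le.trans (Finset.sum_le_sum fun m _ => Finset.card_biUnion_le)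
    _ ≤ ∑ m ∈ Finset.range ℓ, (2 * Fintype.card ι) ^ ℓ *
          (2 * ℓ * Fintype.card (ι → PGL(2, ZMod p))) := by
        rw [Finset.sum_mul]
        refine Finset.sum_le_sum fun m hm => ?_
        rw [Finset.sum_mul]
        refine (Finset.sum_le_card_nsmul _ _ _ (hword m hm)).trans ?_
        rw [smul_eq_mul]
        refine Nat.mul_le_mul_right _ ((Finset.card_filter_le _ _).trans ?_)
        rw [Finset.card_univ, Fintype.card_fun, Fintype.card_prod, Fintype.card_bool,
          Fintype.card_fin, mul_comm]
        refine Nat.pow_le_pow_right ?_ (Finset.mem_range.1 hm)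
        have := Fintype.card_pos (α := ι)
        lia
    _ = _ := by
        rw [Finset.sum_const, Finset.card_range, smul_eq_mul]; ring

end Girth

section Averages

variable {G ι α : Type} [Group G] [Fintype G] [Fintype ι] [DecidableEq ι] [Fintype α]
  [DecidableEq α] [Nonempty α]

open Classical in
-- Markov's inequality for the bound `X` of `norm_familyAverage_sub_pow_le`. As `X` does not involve
-- the representation, all representations are handled at once.
lemma card_not_hasSmallAverages_le (e : α ↪ ι) {ε : ℝ} (hε : 0 < ε) (s n : ℕ) (hn : n = 2 ^ s) :
    ((Finset.univ.filter fun h : ι → G => ¬ HasSmallAverages (h ∘ e) ε).card : ℝ) *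
        (ε ^ (4 * n) * Fintype.card α ^ (2 * n)) ≤
      Fintype.card (ι → G) * (Fintype.card G * (2 * n : ℝ) ^ (4 * n)) := by
  have hα : (0 : ℝ) < Fintype.card α := by exact_mod_cast Fintype.card_pos
  have hn0 : n ≠ 0 := by rw [hn]; positivity
  set X : (ι → G) → ℝ := fun h => Fintype.card G * altCount (h ∘ e) (2 * n + 2 * n) 1 /
    (Fintype.card α : ℝ) ^ (4 * n) - 1 with hX
  -- The trivial representation on `ℂ` already shows that the bound is nonnegative.
  have hX0 : ∀ h, 0 ≤ X h := fun h =>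
    le_trans (by positivity) (norm_familyAverage_sub_pow_le (A := ℂ) 1 (h ∘ e) (by simp) (by simp)
      s n hn)
  have hXsum : ∑ h, X h ≤
      Fintype.card (ι → G) * (Fintype.card G * (2 * n : ℝ) ^ (4 * n)) /
        Fintype.card α ^ (2 * n) := by
    have h1 := card_mul_sum_card_signedWord_le (G := G) e (altSign (2 * n + 2 * n))
    have h2 : (2 * n + 2 * n) / 2 = 2 * n := by lia
    have h3 : ∀ h : ι → G, (Finset.univ.filter fun f : Fin (2 * n + 2 * n) → α =>
        signedWord h (altSign (2 * n + 2 * n)) (e ∘ f) = 1).card =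
        altCount (h ∘ e) (2 * n + 2 * n) 1 := fun h => rfl
    simp only [h2, h3] at h1
    rw [show 2 * n + 2 * n = 4 * n by ring] at h1
    have h4 : (Fintype.card G : ℝ) * ∑ h : ι → G, (altCount (h ∘ e) (4 * n) 1 : ℝ) ≤
        Fintype.card (ι → G) * (Fintype.card α ^ (4 * n) +
          Fintype.card G * (Fintype.card α ^ (2 * n) * (2 * n) ^ (4 * n))) := by
      exact_mod_cast h1
    have h5 : ∑ h, X h = (Fintype.card G * ∑ h : ι → G, (altCount (h ∘ e) (4 * n) 1 : ℝ)) /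
        (Fintype.card α : ℝ) ^ (4 * n) - Fintype.card (ι → G) := by
      simp only [hX, Finset.sum_sub_distrib, ← Finset.sum_div, ← Finset.mul_sum, Finset.sum_const,
        Finset.card_univ, nsmul_eq_mul, mul_one]
      rw [show 2 * n + 2 * n = 4 * n by ring]
    rw [h5, sub_le_iff_le_add, div_le_iff₀ (by positivity)]
    refine h4.trans (le_of_eq ?_)
    have h6 : (Fintype.card α : ℝ) ^ (4 * n) =
      Fintype.card α ^ (2 * n) * Fintype.card α ^ (2 * n) := by rw [← pow_add]; congr 1; ring
    rw [h6]
    field_simp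
    ring
  have hbad : ∀ h ∈ Finset.univ.filter (fun h : ι → G => ¬ HasSmallAverages (h ∘ e) ε),
      ε ^ (4 * n) ≤ X h := by
    intro h hh
    by_contra! hlt
    refine (Finset.mem_filter.1 hh).2 ?_
    intro A _ _ _ _ _ U hU hU1
    refine le_of_pow_le_pow_left₀ (n := 4 * n) (by lia) hε.le ?_
    exact (norm_familyAverage_sub_pow_le U (h ∘ e) hU hU1 s n hn).trans hlt.le
  have h1 := Finset.card_nsmul_le_sum _ _ _ hbad
  rw [nsmul_eq_mul] at h1
  have h2 := h1.trans ((Finset.sum_le_sum_of_subset_of_nonneg (Finset.filter_subset _ _)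
    fun h _ _ => hX0 h).trans hXsum)
  rw [le_div_iff₀ (by positivity)] at h2
  linarith

end Averages

lemma card_PGL_le {p : ℕ} [Fact p.Prime] [Fintype (PGL(2, ZMod p))] :
    Fintype.card (PGL(2, ZMod p)) ≤ p ^ 4 := by
  have h1 : Nat.card (PGL(2, ZMod p)) ≤ Nat.card (GL (Fin 2) (ZMod p)) :=
    Nat.card_le_card_of_surjective _ Matrix.ProjGenLinGroup.mk_surjective
  have h2 : Nat.card (GL (Fin 2) (ZMod p)) ≤ Nat.card (Matrix (Fin 2) (Fin 2) (ZMod p)) :=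
    Nat.card_le_card_of_injective _ Units.val_injective
  have h3 : Nat.card (Matrix (Fin 2) (Fin 2) (ZMod p)) = p ^ 4 := by
    rw [← Nat.card_congr (Matrix.of (m := Fin 2) (n := Fin 2) (α := ZMod p))]
    simp only [Nat.card_eq_fintype_card, Fintype.card_fun, Fintype.card_fin, ZMod.card]
    ring
  rw [← Nat.card_eq_fintype_card]
  lia

/-- For all large `r` and all suitable primes `p`, a random family has large girth and small
averages. -/
lemma exists_family_of_bounds {p : ℕ} [Fact p.Prime] [Fintype (PGL(2, ZMod p))] (N r ℓ s n : ℕ)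
    (hN : 0 < N) (hr : 0 < r) (hn : n = 2 ^ s) {ε : ℝ} (hε : 0 < ε)
    (h1 : (N * r) ^ 2 + 1 < p) (h2 : 4 * (N * r) ≤ p)
    (h3 : 4 * ℓ ^ 2 * (2 * (N * r)) ^ ℓ < p - 1)
    (h4 : 2 * N * ((p : ℝ) ^ 4 * (2 * n : ℝ) ^ (4 * n)) < ε ^ (4 * n) * r ^ (2 * n)) :
    ∃ h : Fin N × Fin r → PGL(2, ZMod p), HasLargeGirth h ℓ ∧
      ∀ i, HasSmallAverages (fun j => h (i, j)) ε := by
  classical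
  have : Nonempty (Fin N × Fin r) := ⟨(⟨0, hN⟩, ⟨0, hr⟩)⟩
  have : Nonempty (Fin r) := ⟨⟨0, hr⟩⟩
  set Ω := Fin N × Fin r → PGL(2, ZMod p)
  have hΩ : 0 < Fintype.card Ω := Fintype.card_pos
  have hcard : Fintype.card (Fin N × Fin r) = N * r := by simp
  set B₁ := Finset.univ.filter fun h : Ω => ¬ HasLargeGirth h ℓ with hB₁
  let e : Fin N → Fin r ↪ Fin N × Fin r := fun i => ⟨fun j => (i, j), fun _ _ hj =>
    congrArg Prod.snd hj⟩
  set B₂ : Fin N → Finset Ω := fun i =>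
    Finset.univ.filter fun h : Ω => ¬ HasSmallAverages (h ∘ e i) ε with hB₂
  have hb₁ : 2 * B₁.card < Fintype.card Ω := by
    have h5 := card_not_hasLargeGirth_le (p := p) (ι := Fin N × Fin r) ℓ (by rwa [hcard])
      (by rwa [hcard])
    rw [hcard] at h5
    refine lt_of_mul_lt_mul_right (a := p - 1) ?_ (Nat.zero_le _)
    calc 2 * B₁.card * (p - 1) = 2 * (B₁.card * (p - 1)) := by ring
      _ ≤ 2 * (2 * ℓ ^ 2 * (2 * (N * r)) ^ ℓ * Fintype.card Ω) := Nat.mul_le_mul_left _ h5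
      _ = Fintype.card Ω * (4 * ℓ ^ 2 * (2 * (N * r)) ^ ℓ) := by ring
      _ < Fintype.card Ω * (p - 1) := Nat.mul_lt_mul_of_pos_left h3 hΩ
  have hb₂ : ∀ i, 2 * N * ((B₂ i).card : ℝ) < Fintype.card Ω := by
    intro i
    have h5 := card_not_hasSmallAverages_le (G := PGL(2, ZMod p)) (e i) hε s n hn
    rw [Fintype.card_fin] at h5
    have h6 : (Fintype.card (PGL(2, ZMod p)) : ℝ) ≤ (p : ℝ) ^ 4 := by
      exact_mod_cast card_PGL_le (p := p)
    refine lt_of_mul_lt_mul_right (a := ε ^ (4 * n) * (r : ℝ) ^ (2 * n)) ?_ (by positivity)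
    calc 2 * N * ((B₂ i).card : ℝ) * (ε ^ (4 * n) * (r : ℝ) ^ (2 * n))
        = 2 * N * ((B₂ i).card * (ε ^ (4 * n) * (r : ℝ) ^ (2 * n))) := by ring
      _ ≤ 2 * N * (Fintype.card Ω * (Fintype.card (PGL(2, ZMod p)) * (2 * n : ℝ) ^ (4 * n))) :=
          mul_le_mul_of_nonneg_left h5 (by positivity)
      _ ≤ 2 * N * (Fintype.card Ω * ((p : ℝ) ^ 4 * (2 * n : ℝ) ^ (4 * n))) := by gcongr
      _ = Fintype.card Ω * (2 * N * ((p : ℝ) ^ 4 * (2 * n : ℝ) ^ (4 * n))) := by ring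
      _ < _ := mul_lt_mul_of_pos_left h4 (by exact_mod_cast hΩ)
  -- Fewer than half of the tuples violate the girth condition, and at most half violate the
  -- condition on some row.
  have hb : (B₁ ∪ Finset.univ.biUnion B₂).card < (Finset.univ : Finset Ω).card := by
    have h5 : (Finset.univ.biUnion B₂).card ≤ ∑ i, (B₂ i).card := Finset.card_biUnion_le
    have h6 : N * (2 * ∑ i, (B₂ i).card) ≤ N * Fintype.card Ω := by
      have : ∑ i, 2 * N * (B₂ i).card ≤ ∑ i : Fin N, Fintype.card Ω :=
        Finset.sum_le_sum fun i _ => by exact_mod_cast (hb₂ i).le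
      simp only [← Finset.mul_sum, Finset.sum_const, Finset.card_univ, Fintype.card_fin,
        smul_eq_mul] at this
      linarith
    have h7 := le_of_mul_le_mul_left h6 hN
    have h8 := Finset.card_union_le B₁ (Finset.univ.biUnion B₂)
    rw [Finset.card_univ]
    lia
  obtain ⟨h, -, hh⟩ := Finset.exists_mem_notMem_of_card_lt_card hb
  simp only [hB₁, hB₂, Finset.mem_union, Finset.mem_biUnion, Finset.mem_filter, Finset.mem_univ,
    true_and, not_or, not_not, not_exists] at hh
  exact ⟨h, hh.1, hh.2⟩

/-- The parameters are chosen in the order `D`, `n`, `r`, `p`. Girth needs `p` to exceed a multiple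
of `r ^ ℓ`, whence `p > r ^ D`; averages need `r ^ (2 n)` to exceed a multiple of `p ^ 4 ≤ 16 r ^ (4
D)`, whence `2 n ≥ 4 D + 1`. -/
theorem exists_family (N ℓ P : ℕ) (hN : 0 < N) {ε : ℝ} (hε : 0 < ε) :
    ∃ p : Nat.Primes, P ≤ p ∧ ∃ r, 2 ≤ r ∧ ∃ h : Fin N × Fin r → PGLTwo p,
      HasLargeGirth h ℓ ∧ ∀ i, HasSmallAverages (fun j => h (i, j)) ε := by
  set D := ℓ + 3 with hD
  set s := 2 * D + 1
  set n := 2 ^ s with hn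
  obtain ⟨C, hC⟩ := exists_nat_gt (32 * N * (2 * n : ℝ) ^ (4 * n) / ε ^ (4 * n))
  -- Each summand serves one of the inequalities below: the extra factor `r` left over in each of
  -- them absorbs its constant.
  set r := P + C + N ^ 2 + 2 + 4 * N + 4 * ℓ ^ 2 * (2 * N) ^ ℓ with hr
  have hr0 : 0 < r := by lia
  -- Bertrand's postulate.
  obtain ⟨p, hlt, hle⟩ : ∃ p : Nat.Primes, r ^ D < p ∧ (p : ℕ) ≤ 2 * r ^ D := by
    obtain ⟨p, hp, h⟩ := Nat.exists_prime_lt_and_le_two_mul (r ^ D) (by positivity)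
    exact ⟨⟨p, hp⟩, h⟩
  have hpow : ∀ a b : ℕ, a ≤ b → r ^ a ≤ r ^ b := fun a b h => Nat.pow_le_pow_right hr0 h
  have : Fact (p : ℕ).Prime := ⟨p.2⟩
  have hrD : r ≤ r ^ D := Nat.le_self_pow (by lia) r
  refine ⟨p, by lia, r, by lia, ?_⟩
  refine exists_family_of_bounds (p := p) N r ℓ s n hN hr0 hn hε ?_ ?_ ?_ ?_
  · have h1 : (N ^ 2 + 1) * r ^ 2 ≤ r * r ^ 2 := Nat.mul_le_mul_right _ (by lia)
    have h2 := hpow 3 D (by lia)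
    have h3 : 1 ≤ r ^ 2 := Nat.one_le_pow _ _ hr0
    nlinarith
  · have h1 : 4 * N * r ≤ r * r := Nat.mul_le_mul_right _ (by lia)
    have h2 := hpow 2 D (by lia)
    nlinarith
  · have h1 : 4 * ℓ ^ 2 * (2 * N) ^ ℓ * r ^ ℓ < r * r ^ ℓ :=
      Nat.mul_lt_mul_of_pos_right (by lia) (by positivity)
    have h2 := hpow (ℓ + 1) D (by lia)
    have h3 : 4 * ℓ ^ 2 * (2 * (N * r)) ^ ℓ = 4 * ℓ ^ 2 * (2 * N) ^ ℓ * r ^ ℓ := by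
      rw [← mul_assoc 2, mul_pow (2 * N)]; ring
    rw [pow_succ'] at h2
    lia
  · have hε' : 0 < ε ^ (4 * n) := by positivity
    rw [div_lt_iff₀ hε'] at hC
    have hCr : (C : ℝ) ≤ r := by exact_mod_cast (by lia : C ≤ r)
    have hr1 : (0 : ℝ) < r := by exact_mod_cast hr0
    have h1 : (p : ℝ) ^ 4 ≤ 16 * (r : ℝ) ^ (4 * D) := by
      have : (p : ℝ) ≤ 2 * (r : ℝ) ^ D := by exact_mod_cast hle
      calc (p : ℝ) ^ 4 ≤ (2 * (r : ℝ) ^ D) ^ 4 := pow_le_pow_left₀ (by positivity) this 4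
        _ = _ := by rw [mul_pow, ← pow_mul]; norm_num [mul_comm]
    have h2 : (r : ℝ) ^ (4 * D + 1) ≤ (r : ℝ) ^ (2 * n) := by
      have : 4 * D + 1 ≤ 2 * n := by
        have := Nat.lt_two_pow_self (n := s)
        lia
      exact_mod_cast hpow _ _ this
    calc 2 * N * ((p : ℝ) ^ 4 * (2 * n : ℝ) ^ (4 * n))
        ≤ 2 * N * (16 * (r : ℝ) ^ (4 * D) * (2 * n : ℝ) ^ (4 * n)) := by gcongr
      _ = 32 * N * (2 * n : ℝ) ^ (4 * n) * (r : ℝ) ^ (4 * D) := by ring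
      _ < C * ε ^ (4 * n) * (r : ℝ) ^ (4 * D) := mul_lt_mul_of_pos_right hC (by positivity)
      _ ≤ r * ε ^ (4 * n) * (r : ℝ) ^ (4 * D) := by gcongr
      _ = ε ^ (4 * n) * (r : ℝ) ^ (4 * D + 1) := by ring
      _ ≤ _ := by gcongr

/-! ### Compactness from estimates along a filtration -/

section Filtration

variable {H : Type*} [NormedAddCommGroup H] [InnerProductSpace ℂ H]
  {V : ℕ → Submodule ℂ H} [∀ n, FiniteDimensional ℂ (V n)] {T : H →L[ℂ] H} {ε : ℕ → ℝ}

/-- `T` is block diagonal for the filtration, so by Pythagoras its norm is governed by the largest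
block, which is the first since `ε` decreases. -/
lemma norm_apply_le_of_mem_of_mem_orthogonal (hV : Monotone V)
    (hT : ∀ n, ∀ ξ ∈ V n, T ξ ∈ V n) (hT' : ∀ n, ∀ ξ ∈ (V n)ᗮ, T ξ ∈ (V n)ᗮ)
    (hε : Antitone ε) (hε0 : ∀ n, 0 ≤ ε n)
    (hb : ∀ n, ∀ ξ ∈ V (n + 1), ξ ∈ (V n)ᗮ → ‖T ξ‖ ≤ ε n * ‖ξ‖) {n N : ℕ} (hn : n ≤ N) :
    ∀ ξ ∈ V N, ξ ∈ (V n)ᗮ → ‖T ξ‖ ≤ ε n * ‖ξ‖ := by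
  induction N, hn using Nat.le_induction with
  | base =>
    intro ξ h1 h2
    have : ξ = 0 := by simpa using (Submodule.mem_orthogonal _ _).1 h2 ξ h1
    simp [this]
  | succ N hnN ih =>
    intro ξ h1 h2
    set η := (V N).starProjection ξ
    have hη : η ∈ V N := Submodule.starProjection_apply_mem _ _
    have hζ : ξ - η ∈ (V N)ᗮ := Submodule.sub_starProjection_mem_orthogonal ξ
    have hη' : η ∈ (V n)ᗮ := by
      have : η = ξ - (ξ - η) := by abel
      rw [this]
      exact Submodule.sub_mem _ h2 (Submodule.orthogonal_le (hV hnN) hζ)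
    have e1 := ih η hη hη'
    have e2 := hb N (ξ - η) (Submodule.sub_mem _ h1 (hV (Nat.le_succ N) hη)) hζ
    have e3 : ‖T (ξ - η)‖ ≤ ε n * ‖ξ - η‖ :=
      e2.trans (mul_le_mul_of_nonneg_right (hε hnN) (norm_nonneg _))
    have p1 : ‖ξ‖ * ‖ξ‖ = ‖η‖ * ‖η‖ + ‖ξ - η‖ * ‖ξ - η‖ := by
      rw [← norm_add_sq_eq_norm_sq_add_norm_sq_of_inner_eq_zero η (ξ - η)
        ((Submodule.mem_orthogonal _ _).1 hζ η hη)]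
      simp
    have p2 : ‖T ξ‖ * ‖T ξ‖ = ‖T η‖ * ‖T η‖ + ‖T (ξ - η)‖ * ‖T (ξ - η)‖ := by
      rw [← norm_add_sq_eq_norm_sq_add_norm_sq_of_inner_eq_zero (T η) (T (ξ - η))
        ((Submodule.mem_orthogonal _ _).1 (hT' N _ hζ) _ (hT N _ hη)), ← map_add]
      simp
    refine abs_le_of_sq_le_sq' ?_ (mul_nonneg (hε0 n) (norm_nonneg _)) |>.2
    have q1 := mul_self_le_mul_self (norm_nonneg _) e1
    have q2 := mul_self_le_mul_self (norm_nonneg _) e3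
    have q3 : (ε n * ‖ξ‖) ^ 2 = ε n * ‖η‖ * (ε n * ‖η‖) + ε n * ‖ξ - η‖ * (ε n * ‖ξ - η‖) := by
      rw [mul_pow, sq ‖ξ‖, p1]
      ring
    rw [sq, p2, q3]
    exact add_le_add q1 q2

lemma norm_apply_le_of_mem_orthogonal [CompleteSpace H] (hV : Monotone V)
    (hVd : ⊤ ≤ (⨆ n, V n).topologicalClosure)
    (hT : ∀ n, ∀ ξ ∈ V n, T ξ ∈ V n) (hT' : ∀ n, ∀ ξ ∈ (V n)ᗮ, T ξ ∈ (V n)ᗮ)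
    (hε : Antitone ε) (hε0 : ∀ n, 0 ≤ ε n)
    (hb : ∀ n, ∀ ξ ∈ V (n + 1), ξ ∈ (V n)ᗮ → ‖T ξ‖ ≤ ε n * ‖ξ‖) (n : ℕ) {ξ : H}
    (hξ : ξ ∈ (V n)ᗮ) : ‖T ξ‖ ≤ ε n * ‖ξ‖ := by
  have hlim : Tendsto (fun N => (V N).starProjection ξ) atTop (𝓝 ξ) :=
    Submodule.starProjection_tendsto_self V hV ξ hVd
  refine le_of_tendsto_of_tendsto ((T.continuous.tendsto ξ).comp hlim).norm
    (hlim.norm.const_mul (ε n)) ?_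
  filter_upwards [eventually_ge_atTop n] with N hN
  refine norm_apply_le_of_mem_of_mem_orthogonal hV hT hT' hε hε0 hb hN _
    (Submodule.starProjection_apply_mem _ _) ?_
  have : (V N).starProjection ξ = ξ - (ξ - (V N).starProjection ξ) := by abel
  change (V N).starProjection ξ ∈ _
  rw [this]
  exact Submodule.sub_mem _ hξ
    (Submodule.orthogonal_le (hV hN) (Submodule.sub_starProjection_mem_orthogonal ξ))

/-- `T` is the norm limit of the finite rank operators obtained by composing it with the projections
on `V n`. -/
lemma isCompactOperator_of_norm_apply_le_on_orthogonal [CompleteSpace H]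
    (hT : ∀ n, ∀ ξ ∈ (V n)ᗮ, ‖T ξ‖ ≤ ε n * ‖ξ‖) (hε0 : ∀ n, 0 ≤ ε n)
    (hε : Tendsto ε atTop (𝓝 0)) : IsCompactOperator T := by
  have hlim : Tendsto (fun n => T ∘L (V n).starProjection) atTop (𝓝 T) := by
    rw [tendsto_iff_norm_sub_tendsto_zero]
    refine squeeze_zero (fun _ => norm_nonneg _) (fun n => ?_) hε
    refine ContinuousLinearMap.opNorm_le_bound _ (hε0 n) fun ξ => ?_
    have h1 : (T ∘L (V n).starProjection - T) ξ = - T (ξ - (V n).starProjection ξ) := by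
      simp
    rw [h1, norm_neg]
    refine (hT n _ (Submodule.sub_starProjection_mem_orthogonal ξ)).trans
      (mul_le_mul_of_nonneg_left ?_ (hε0 n))
    rw [← Submodule.starProjection_orthogonal_val]
    exact Submodule.norm_starProjection_apply_le _ ξ
  refine isCompactOperator_of_tendsto hlim (Eventually.of_forall fun n => ?_)
  have : ProperSpace (V n) := FiniteDimensional.proper ℂ (V n)
  have h2 : IsCompactOperator (V n).orthogonalProjectionOnto :=
    isCompactOperator_of_locallyCompactSpace_dom _
  exact h2.clm_comp (T ∘L (V n).subtypeL)

end Filtration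

/-! ### The left regular representation -/

/-- Left translation of continuous functions. -/
def leftTranslate {K : Type*} [Group K] [TopologicalSpace K] [IsTopologicalGroup K] (x : K)
    (f : C(K, ℂ)) : C(K, ℂ) :=
  f.comp ⟨fun y => x⁻¹ * y, continuous_const.mul continuous_id⟩

lemma leftTranslate_apply {K : Type*} [Group K] [TopologicalSpace K] [IsTopologicalGroup K]
    (x y : K) (f : C(K, ℂ)) : leftTranslate x f y = f (x⁻¹ * y) := rfl

section LeftRegular

variable {K : Type*} [Group K] [TopologicalSpace K] [IsTopologicalGroup K] [CompactSpace K]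
  [MeasurableSpace K] [BorelSpace K]

lemma leftRegular_one (ξ : L2 K) : leftRegular (1 : K) ξ = ξ := by
  change DomMulAct.mk (1 : K)⁻¹ • ξ = ξ
  rw [inv_one]
  exact one_smul _ ξ

lemma leftRegular_mul (x y : K) (ξ : L2 K) :
    leftRegular (x * y) ξ = leftRegular x (leftRegular y ξ) := by
  change DomMulAct.mk (x * y)⁻¹ • ξ = DomMulAct.mk x⁻¹ • DomMulAct.mk y⁻¹ • ξ
  rw [mul_inv_rev, smul_smul]
  rfl

lemma leftRegular_inv_leftRegular (x : K) (ξ : L2 K) :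
    leftRegular x⁻¹ (leftRegular x ξ) = ξ := by
  rw [← leftRegular_mul, inv_mul_cancel, leftRegular_one]

lemma inner_leftRegular_left (x : K) (ξ η : L2 K) :
    inner ℂ (leftRegular x ξ) η = inner ℂ ξ (leftRegular x⁻¹ η) := by
  rw [← (leftRegular x⁻¹).inner_map_map, leftRegular_inv_leftRegular]

/-- The left regular representation, as a homomorphism to the algebra of bounded operators. -/
def leftRegularHom : K →* (L2 K →L[ℂ] L2 K) where
  toFun x := (leftRegular x).toContinuousLinearMap
  map_one' := by ext1 ξ; exact leftRegular_one ξ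
  map_mul' x y := by ext1 ξ; exact leftRegular_mul x y ξ

lemma leftRegularHom_apply (x : K) (ξ : L2 K) : leftRegularHom x ξ = leftRegular x ξ := rfl

lemma star_leftRegularHom (x : K) : star (leftRegularHom x) = leftRegularHom x⁻¹ := by
  rw [ContinuousLinearMap.star_eq_adjoint, eq_comm, ContinuousLinearMap.eq_adjoint_iff]
  intro ξ η
  rw [leftRegularHom_apply, leftRegularHom_apply, inner_leftRegular_left, inv_inv]

lemma norm_leftRegularHom_le (x : K) : ‖leftRegularHom x‖ ≤ 1 :=
  (leftRegular x).norm_toContinuousLinearMap_le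

lemma leftRegular_mem_orthogonal {W : Submodule ℂ (L2 K)}
    (hW : ∀ x : K, ∀ ξ ∈ W, leftRegular x ξ ∈ W) (x : K) {ξ : L2 K} (hξ : ξ ∈ Wᗮ) :
    leftRegular x ξ ∈ Wᗮ := by
  rw [Submodule.mem_orthogonal'] at hξ ⊢
  intro η hη
  rw [inner_leftRegular_left]
  exact hξ _ (hW _ _ hη)

lemma convOp_apply (ν : Measure K) [IsProbabilityMeasure ν] (ξ : L2 K) :
    convOp ν ξ = ∫ x, leftRegular x ξ ∂ν := rfl

lemma convOp_mem_orthogonal (ν : Measure K) [IsProbabilityMeasure ν] {W : Submodule ℂ (L2 K)}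
    (hW : ∀ x : K, ∀ ξ ∈ W, leftRegular x ξ ∈ W) {ξ : L2 K} (hξ : ξ ∈ Wᗮ) :
    convOp ν ξ ∈ Wᗮ := by
  rw [Submodule.mem_orthogonal]
  intro η hη
  rw [convOp_apply, ← integral_inner (integrable_leftRegular ν ξ)]
  simp [(Submodule.mem_orthogonal _ _).1 (leftRegular_mem_orthogonal hW _ hξ) η hη]

/-- `W` is its own double orthogonal, being finite-dimensional, so the orthogonal case applies to
`Wᗮ`. -/
lemma convOp_mem (ν : Measure K) [IsProbabilityMeasure ν] {W : Submodule ℂ (L2 K)}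
    [FiniteDimensional ℂ W]
    (hW : ∀ x : K, ∀ ξ ∈ W, leftRegular x ξ ∈ W) {ξ : L2 K} (hξ : ξ ∈ W) :
    convOp ν ξ ∈ W := by
  rw [← Submodule.orthogonal_orthogonal W] at hξ ⊢
  exact convOp_mem_orthogonal ν (fun x ξ h => leftRegular_mem_orthogonal hW x h) hξ

/-- The element of `L²(K)` given by a continuous function. -/
def contToL2 : C(K, ℂ) →L[ℂ] L2 K := ContinuousMap.toLp 2 (haarProb K) ℂ

lemma leftRegular_contToL2 (x : K) (f : C(K, ℂ)) :
    leftRegular x (contToL2 f) = contToL2 (leftTranslate x f) := by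
  rfl

lemma contToL2_injective : Function.Injective (contToL2 (K := K)) :=
  ContinuousMap.toLp_injective _

lemma denseRange_contToL2 [(haarProb K).WeaklyRegular] : DenseRange (contToL2 (K := K)) :=
  ContinuousMap.toLp_denseRange _ _ _ ENNReal.ofNat_ne_top

end LeftRegular

/-! ### Functions of finitely many coordinates -/

section Cylinder

lemma exists_cylinder_subset_of_mem_nhds {E : ℕ → Type*} [∀ n, TopologicalSpace (E n)]
    [∀ n, DiscreteTopology (E n)] {x : ∀ n, E n} {s : Set (∀ n, E n)} (hs : s ∈ 𝓝 x) :
    ∃ n, PiNat.cylinder x n ⊆ s := by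
  obtain ⟨t, ⟨y, n, rfl⟩, hx, ht⟩ :=
    (PiNat.isTopologicalBasis_cylinders E).mem_nhds_iff.1 hs
  exact ⟨n, by rwa [PiNat.mem_cylinder_iff_eq.1 hx]⟩

/-- Replace the coordinates from `n` on by the identity. -/
def truncate {Γ : ℕ → Type*} [∀ n, Group (Γ n)] (n : ℕ) (x : ∀ n, Γ n) : ∀ n, Γ n :=
  fun m => if m < n then x m else 1

lemma truncate_apply_of_lt {Γ : ℕ → Type*} [∀ n, Group (Γ n)] {m n : ℕ} (h : m < n)
    (x : ∀ n, Γ n) : truncate n x m = x m :=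
  if_pos h

variable (Γ : ℕ → Type) [∀ n, TopologicalSpace (Γ n)]

/-- The continuous functions that depend on the first `n` coordinates only. -/
def cylFunctions (n : ℕ) : Submodule ℂ C(∀ n, Γ n, ℂ) where
  carrier := {f | ∀ x y, (∀ m < n, x m = y m) → f x = f y}
  add_mem' hf hg x y h := by simp [hf x y h, hg x y h]
  zero_mem' _ _ _ := rfl
  smul_mem' c f hf x y h := by simp [hf x y h]

variable {Γ}

lemma cylFunctions_mono : Monotone (cylFunctions Γ) := fun _ _ hmn _ hf x y h =>
  hf x y fun k hk => h k (hk.trans_le hmn)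

variable [∀ n, Group (Γ n)]

lemma continuous_truncate (n : ℕ) : Continuous (truncate (Γ := Γ) n) := by
  refine continuous_pi fun m => ?_
  unfold truncate
  split_ifs
  · exact continuous_apply m
  · exact continuous_const

instance [∀ n, Finite (Γ n)] (n : ℕ) : FiniteDimensional ℂ (cylFunctions Γ n) := by
  let L : cylFunctions Γ n →ₗ[ℂ] ((∀ m : Fin n, Γ m) → ℂ) :=
    { toFun := fun f a => f.1 fun m => if h : m < n then a ⟨m, h⟩ else 1
      map_add' := fun _ _ => rfl
      map_smul' := fun _ _ => rfl }
  refine Module.Finite.of_injective L fun f g hfg => ?_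
  ext x
  have h1 := congrFun hfg fun m => x m
  refine (f.2 x (truncate n x) fun m hm => (truncate_apply_of_lt hm x).symm).trans
    (Eq.trans ?_ (g.2 _ x fun m hm => truncate_apply_of_lt hm x))
  exact h1

lemma tendsto_comp_truncate [∀ n, DiscreteTopology (Γ n)] [∀ n, Finite (Γ n)]
    (f : C(∀ n, Γ n, ℂ)) :
    Tendsto (fun n => f.comp ⟨truncate n, continuous_truncate n⟩) atTop (𝓝 f) := by
  rw [ContinuousMap.tendsto_iff_tendstoLocallyUniformly, Metric.tendstoLocallyUniformly_iff]
  intro ε hε x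
  obtain ⟨N, hN⟩ := exists_cylinder_subset_of_mem_nhds
    (f.continuous.continuousAt.preimage_mem_nhds (Metric.ball_mem_nhds (f x) (half_pos hε)))
  refine ⟨PiNat.cylinder x N,
    (PiNat.isOpen_cylinder Γ x N).mem_nhds (PiNat.self_mem_cylinder x N), ?_⟩
  filter_upwards [eventually_ge_atTop N] with n hn y hy
  have hy' : truncate n y ∈ PiNat.cylinder x N := fun m hm => by
    rw [truncate_apply_of_lt (lt_of_lt_of_le hm hn)]
    exact hy m hm
  have h1 : dist (f y) (f x) < ε / 2 := hN hy
  have h2 : dist (f (truncate n y)) (f x) < ε / 2 := hN hy'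
  calc dist (f y) (f (truncate n y)) ≤ dist (f y) (f x) + dist (f (truncate n y)) (f x) :=
        dist_triangle_right _ _ _
    _ < ε := by linarith

lemma leftTranslate_mem_cylFunctions [∀ n, DiscreteTopology (Γ n)] {n : ℕ} (x : ∀ n, Γ n)
    {f : C(∀ n, Γ n, ℂ)}
    (hf : f ∈ cylFunctions Γ n) : leftTranslate x f ∈ cylFunctions Γ n := fun y z h =>
  hf _ _ fun m hm => by simp [h m hm]

variable [∀ n, DiscreteTopology (Γ n)] [∀ n, Fintype (Γ n)] [∀ n, MeasurableSpace (Γ n)]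
  [∀ n, BorelSpace (Γ n)]

variable (Γ) in
/-- The elements of `L²` that depend on the first `n` coordinates only. -/
def cylL2 (n : ℕ) : Submodule ℂ (L2 (∀ n, Γ n)) :=
  (cylFunctions Γ n).map (contToL2 (K := ∀ n, Γ n)).toLinearMap

instance (n : ℕ) : FiniteDimensional ℂ (cylL2 Γ n) := by
  unfold cylL2; infer_instance

lemma contToL2_mem_cylL2 {n : ℕ} {f : C(∀ n, Γ n, ℂ)} (hf : f ∈ cylFunctions Γ n) :
    contToL2 f ∈ cylL2 Γ n := ⟨f, hf, rfl⟩

lemma cylL2_mono : Monotone (cylL2 Γ) := fun _ _ h => Submodule.map_mono (cylFunctions_mono h)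

lemma topologicalClosure_iSup_cylL2 : ⊤ ≤ (⨆ n, cylL2 Γ n).topologicalClosure := by
  intro ξ _
  have h1 : ∀ f : C(∀ n, Γ n, ℂ), contToL2 f ∈ (⨆ n, cylL2 Γ n).topologicalClosure := fun f => by
    refine mem_closure_of_tendsto
      ((contToL2.continuous.tendsto f).comp (tendsto_comp_truncate f))
      (Eventually.of_forall fun n => ?_)
    refine Submodule.mem_iSup_of_mem n (contToL2_mem_cylL2 fun x y h => ?_)
    refine congrArg f (funext fun m => ?_)
    by_cases hm : m < n <;> simp [truncate, hm, h]
  exact closure_minimal (Set.range_subset_iff.2 h1) isClosed_closure (denseRange_contToL2 ξ)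

lemma leftRegular_mem_cylL2 {n : ℕ} (x : ∀ n, Γ n) (ξ : L2 (∀ n, Γ n)) (hξ : ξ ∈ cylL2 Γ n) :
    leftRegular x ξ ∈ cylL2 Γ n := by
  obtain ⟨f, hf, rfl⟩ := hξ
  exact contToL2_mem_cylL2 (leftTranslate_mem_cylFunctions x hf)

lemma leftRegular_eq_of_mem_cylL2 {n : ℕ} {x y : ∀ n, Γ n} (h : ∀ m < n, x m = y m)
    {ξ : L2 (∀ n, Γ n)} (hξ : ξ ∈ cylL2 Γ n) : leftRegular x ξ = leftRegular y ξ := by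
  obtain ⟨f, hf, rfl⟩ := hξ
  change leftRegular x (contToL2 f) = leftRegular y (contToL2 f)
  rw [leftRegular_contToL2, leftRegular_contToL2]
  refine congrArg contToL2 (ContinuousMap.ext fun z => hf _ _ fun m hm => ?_)
  simp [h m hm]

/-- The restriction of the left regular representation to the `n`-th factor. -/
def factorRep (n : ℕ) : Γ n →* (L2 (∀ n, Γ n) →L[ℂ] L2 (∀ n, Γ n)) :=
  leftRegularHom.comp (MonoidHom.mulSingle Γ n)

lemma factorRep_apply (n : ℕ) (g : Γ n) (ξ : L2 (∀ n, Γ n)) :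
    factorRep n g ξ = leftRegular (Pi.mulSingle n g) ξ := rfl

lemma star_factorRep (n : ℕ) (g : Γ n) : star (factorRep n g) = factorRep n g⁻¹ := by
  rw [factorRep, MonoidHom.comp_apply, star_leftRegularHom, MonoidHom.comp_apply,
    map_inv (MonoidHom.mulSingle Γ n)]

/-- The average over the `n`-th factor removes the dependence on the `n`-th coordinate. -/
lemma familyAverage_factorRep_mem {n : ℕ} {ξ : L2 (∀ n, Γ n)} (hξ : ξ ∈ cylL2 Γ (n + 1)) :
    familyAverage (factorRep (Γ := Γ) n) id ξ ∈ cylL2 Γ n := by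
  obtain ⟨f, hf, rfl⟩ := hξ
  have h1 : familyAverage (factorRep (Γ := Γ) n) id (contToL2 f) =
      contToL2 ((Fintype.card (Γ n) : ℂ)⁻¹ •
        ∑ g : Γ n, leftTranslate (Pi.mulSingle n g) f) := by
    simp only [familyAverage, smul_apply, sum_apply,
      map_smul, map_sum, factorRep_apply, leftRegular_contToL2, id]
  change familyAverage (factorRep (Γ := Γ) n) id (contToL2 f) ∈ _
  rw [h1]
  refine contToL2_mem_cylL2 fun x y h => ?_
  simp only [ContinuousMap.smul_apply, ContinuousMap.sum_apply, leftTranslate_apply]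
  congr 1
  -- Translating the summation variable turns `g⁻¹ * x n` into `g⁻¹ * y n`.
  rw [← Equiv.sum_comp (Equiv.mulLeft (x n * (y n)⁻¹))]
  refine Finset.sum_congr rfl fun g _ => hf _ _ fun m hm => ?_
  rcases (Nat.lt_succ_iff_lt_or_eq.1 hm) with hm | rfl
  · simp [Pi.mulSingle_eq_of_ne hm.ne, h m hm]
  · simp [mul_assoc]

/-- `P` is a self-adjoint idempotent sending `ξ` into `cylL2 Γ n`, so `‖P ξ‖² = ⟪P ξ, ξ⟫ = 0`. -/
lemma familyAverage_factorRep_eq_zero {n : ℕ} {ξ : L2 (∀ n, Γ n)} (hξ : ξ ∈ cylL2 Γ (n + 1))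
    (hξ' : ξ ∈ (cylL2 Γ n)ᗮ) : familyAverage (factorRep (Γ := Γ) n) id ξ = 0 := by
  set P := familyAverage (factorRep (Γ := Γ) n) id
  have hP : star P = P := star_familyAverage_id _ (star_factorRep n)
  have hPP : P * P = P := familyAverage_mul_id _ _
  rw [← inner_self_eq_zero (𝕜 := ℂ)]
  have h1 : inner ℂ (P ξ) (P ξ) = inner ℂ (P (P ξ)) ξ := by
    have := ContinuousLinearMap.adjoint_inner_left P ξ (P ξ)
    rw [← ContinuousLinearMap.star_eq_adjoint, hP] at this
    exact this.symm
  rw [h1, ← mul_apply_eq_comp, hPP]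
  exact (Submodule.mem_orthogonal _ _).1 hξ' _ (familyAverage_factorRep_mem hξ)

end Cylinder

/-! ### The norm estimate on one block -/

section KeyEstimate

variable {Γ Λ : ℕ → Type} [∀ n, TopologicalSpace (Γ n)] [∀ n, Group (Γ n)]
  [∀ n, DiscreteTopology (Γ n)] [∀ n, Fintype (Γ n)] [∀ n, MeasurableSpace (Γ n)]
  [∀ n, BorelSpace (Γ n)]
  [∀ n, TopologicalSpace (Λ n)] [∀ n, AddCommGroup (Λ n)]
  [∀ n, DiscreteTopology (Λ n)] [∀ n, Fintype (Λ n)] [∀ n, MeasurableSpace (Λ n)]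
  [∀ n, BorelSpace (Λ n)] {μ : Measure (∀ n, Λ n)} [IsProbabilityMeasure μ]
  [μ.IsAddRightInvariant]

lemma integral_eq_integral_average {E : Type*} [NormedAddCommGroup E] [NormedSpace ℝ E]
    [NormedSpace ℂ E] [SMulCommClass ℝ ℂ E] (n : ℕ) {Φ : (∀ n, Λ n) → E} (hΦ : Continuous Φ) :
    ∫ x, Φ x ∂μ =
      ∫ x, (Fintype.card (Λ n) : ℂ)⁻¹ • ∑ a : Λ n, Φ (x + Pi.single n a) ∂μ := by
  have hint : ∀ Ψ : (∀ n, Λ n) → E, Continuous Ψ → Integrable Ψ μ := fun Ψ h =>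
    h.integrable_of_hasCompactSupport (HasCompactSupport.of_compactSpace _)
  rw [integral_smul, integral_finsetSum _ fun a _ =>
    hint (fun x => Φ (x + Pi.single n a)) (hΦ.comp (continuous_id.add continuous_const))]
  simp only [integral_add_right_eq_self Φ]
  rw [Finset.sum_const, Finset.card_univ, ← Nat.cast_smul_eq_nsmul ℂ, smul_smul,
    inv_mul_cancel₀ (by simp), one_smul]

/-- By invariance of `μ`, the integrand may first be averaged over the `n`-th coordinate. With the
other coordinates fixed, this is a row average in the `n`-th factor, up to one isometry. -/
lemma norm_integral_leftRegular_le {ψ : (∀ n, Λ n) → ∀ n, Γ n} (hψ : Continuous ψ) {n : ℕ}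
    {ε : ℝ}
    (h1 : ∀ (x : ∀ n, Λ n) (a : Λ n), ∀ m < n, ψ (x + Pi.single n a) m = ψ x m)
    (h2 : ∀ x : ∀ n, Λ n, HasSmallAverages (fun a : Λ n => ψ (x + Pi.single n a) n) ε)
    {ξ : L2 (∀ n, Γ n)} (hξ : ξ ∈ cylL2 Γ (n + 1)) (hξ' : ξ ∈ (cylL2 Γ n)ᗮ) :
    ‖∫ x, leftRegular (ψ x) ξ ∂μ‖ ≤ ε * ‖ξ‖ := by
  rw [integral_eq_integral_average n (Φ := fun x => leftRegular (ψ x) ξ)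
    ((continuous_leftRegular ξ).comp hψ)]
  have h3 : ∀ x, ‖(Fintype.card (Λ n) : ℂ)⁻¹ • ∑ a : Λ n,
      leftRegular (ψ (x + Pi.single n a)) ξ‖ ≤ ε * ‖ξ‖ := by
    intro x
    -- The prefix `k` is common to all `a`. Coordinates beyond `n` act trivially on `cylL2 Γ (n +
    -- 1)`, so `ψ (x + Pi.single n a)` acts as `k` times its `n`-th coordinate.
    set k := truncate n (ψ x)
    set T := familyAverage (factorRep (Γ := Γ) n) fun a => ψ (x + Pi.single n a) n
    have h4 : (Fintype.card (Λ n) : ℂ)⁻¹ • ∑ a : Λ n, leftRegular (ψ (x + Pi.single n a)) ξ =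
        leftRegular k (T ξ) := by
      simp only [T, familyAverage, smul_apply, sum_apply,
        map_smul, map_sum, factorRep_apply, ← leftRegular_mul]
      congr 1
      refine Finset.sum_congr rfl fun a _ => leftRegular_eq_of_mem_cylL2 (fun m hm => ?_) hξ
      rcases (Nat.lt_succ_iff_lt_or_eq.1 hm) with hm | rfl
      · simp [k, Pi.mulSingle_eq_of_ne hm.ne, truncate_apply_of_lt hm, h1 x a m hm]
      · simp [k, truncate]
    rw [h4, LinearIsometry.norm_map]
    have h5 : T ξ = (T - familyAverage (factorRep (Γ := Γ) n) id) ξ := by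
      rw [sub_apply, familyAverage_factorRep_eq_zero hξ hξ', sub_zero]
    rw [h5]
    refine ContinuousLinearMap.le_of_opNorm_le _ ?_ ξ
    exact h2 x (L2 (∀ n, Γ n) →L[ℂ] L2 (∀ n, Γ n)) (factorRep n) (star_factorRep n)
      fun g => norm_leftRegularHom_le _
  simpa using norm_integral_le_of_norm_le_const (μ := μ) (ae_of_all _ h3)

lemma HasSmallAverages.inv {G α : Type} [Group G] [Fintype G] [Fintype α] {h : α → G} {ε : ℝ}
    (hh : HasSmallAverages h ε) : HasSmallAverages (fun a => (h a)⁻¹) ε := by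
  intro A _ _ _ _ _ U hU hU1
  rw [← star_familyAverage U hU, ← norm_star, star_sub, star_star, star_familyAverage_id U hU]
  exact hh A U hU hU1

lemma HasSmallAverages.comp_equiv {G α β : Type} [Group G] [Fintype G] [Fintype α] [Fintype β]
    {h : α → G} {ε : ℝ} (hh : HasSmallAverages h ε) (e : β ≃ α) : HasSmallAverages (h ∘ e) ε := by
  intro A _ _ _ _ _ U hU hU1
  have : familyAverage U (h ∘ e) = familyAverage U h := by
    simp only [familyAverage, Fintype.card_congr e, Function.comp_apply,
      Equiv.sum_comp e fun x => U (h x)]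
  rw [this]
  exact hh A U hU hU1

end KeyEstimate

/-! ### Symmetrized image measures and their convolution operators -/

section SymmetricImage

variable {X K : Type*} [TopologicalSpace X] [MeasurableSpace X] [BorelSpace X]
  [Group K] [TopologicalSpace K] [IsTopologicalGroup K] [MeasurableSpace K] [BorelSpace K]

/-- The symmetrization of the image of the measure `μ` under `φ`. -/
def symImage (μ : Measure X) (φ : X → K) : Measure K :=
  (2 : ENNReal)⁻¹ • (μ.map φ + μ.map φ⁻¹)

variable {μ : Measure X} {φ : X → K}

lemma isProbabilityMeasure_symImage [IsProbabilityMeasure μ] (hφ : Continuous φ) :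
    IsProbabilityMeasure (symImage μ φ) := by
  have h1 := Measure.isProbabilityMeasure_map (μ := μ) hφ.aemeasurable
  have h2 := Measure.isProbabilityMeasure_map (μ := μ) hφ.inv.aemeasurable
  constructor
  rw [symImage, Measure.smul_apply, Measure.add_apply, h1.measure_univ,
    h2.measure_univ, one_add_one_eq_two,
    smul_eq_mul, ENNReal.inv_mul_cancel two_ne_zero ENNReal.ofNat_ne_top]

lemma isInvInvariant_symImage (hφ : Continuous φ) : (symImage μ φ).IsInvInvariant := by
  constructor
  rw [Measure.inv, symImage, Measure.map_smul, Measure.map_add _ _ measurable_inv,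
    Measure.map_map measurable_inv hφ.measurable, Measure.map_map measurable_inv hφ.inv.measurable,
    add_comm]
  congr 3
  ext x
  simp

lemma nullSingletonClass_symImage [T1Space K] [NullSingletonClass μ] (hφ : Continuous φ)
    (hinj : Function.Injective φ) : NullSingletonClass (symImage μ φ) := by
  have hinj' : Function.Injective φ⁻¹ := inv_injective.comp hinj
  constructor
  intro k
  rw [symImage, Measure.smul_apply, Measure.add_apply,
    Measure.map_apply hφ.measurable (measurableSet_singleton k),
    Measure.map_apply hφ.inv.measurable (measurableSet_singleton k),
    (Set.subsingleton_singleton.preimage hinj).measure_zero,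
    (Set.subsingleton_singleton.preimage hinj').measure_zero]
  simp

lemma support_map_eq_range {Y : Type*} [TopologicalSpace Y] [T2Space Y] [MeasurableSpace Y]
    [BorelSpace Y] [μ.IsOpenPosMeasure] [CompactSpace X]
    {f : X → Y} (hf : Continuous f) :
    (μ.map f).support = Set.range f := by
  have hcl : IsClosed (Set.range f) := (isCompact_range hf).isClosed
  refine (Measure.support_subset_of_isClosed hcl ?_).antisymm ?_
  · rw [mem_ae_iff, Measure.map_apply hf.measurable hcl.measurableSet.compl]
    convert measure_empty (μ := μ)
    ext x
    simp
  · rintro _ ⟨x, rfl⟩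
    rw [Measure.support_eq_forall_isOpen]
    intro u hxu hu
    rw [Measure.map_apply hf.measurable hu.measurableSet]
    exact (hu.preimage hf).measure_pos μ ⟨x, hxu⟩

lemma support_symImage [CompactSpace X] [T2Space K] [μ.IsOpenPosMeasure] (hφ : Continuous φ) :
    (symImage μ φ).support = Set.range φ ∪ (Set.range φ)⁻¹ := by
  have h1 : (symImage μ φ).support = (μ.map φ + μ.map φ⁻¹).support :=
    (Measure.AbsolutelyContinuous.support_mono Measure.smul_absolutelyContinuous).antisymm
      (Measure.AbsolutelyContinuous.support_mono
        (Measure.absolutelyContinuous_smul (by simp)))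
  rw [h1, Measure.support_add, support_map_eq_range hφ, support_map_eq_range hφ.inv]
  congr 1
  ext k
  simp [inv_eq_iff_eq_inv]

lemma integral_symImage [IsProbabilityMeasure μ] {E : Type*} [NormedAddCommGroup E]
    [NormedSpace ℝ E] [CompactSpace K] [SecondCountableTopologyEither K E]
    (hφ : Continuous φ) {Φ : K → E} (hΦ : Continuous Φ) :
    ∫ k, Φ k ∂(symImage μ φ) =
      (2 : ℝ)⁻¹ • (∫ x, Φ (φ x) ∂μ + ∫ x, Φ (φ x)⁻¹ ∂μ) := by
  have h1 := Measure.isProbabilityMeasure_map (μ := μ) hφ.aemeasurable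
  have h2 := Measure.isProbabilityMeasure_map (μ := μ) hφ.inv.aemeasurable
  have hint : ∀ (m : Measure K) [IsProbabilityMeasure m], Integrable Φ m := fun m _ =>
    hΦ.integrable_of_hasCompactSupport (HasCompactSupport.of_compactSpace _)
  rw [symImage, integral_smul_measure, integral_add_measure (hint _) (hint _),
    integral_map hφ.aemeasurable hΦ.aestronglyMeasurable,
    integral_map hφ.inv.aemeasurable hΦ.aestronglyMeasurable]
  simp

end SymmetricImage

section CompactGroup

variable {K : Type*} [Group K] [TopologicalSpace K] [IsTopologicalGroup K] [CompactSpace K]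
  [MeasurableSpace K] [BorelSpace K] {X : Type*} [TopologicalSpace X]
  [MeasurableSpace X] [BorelSpace X] {μ : Measure X} [IsProbabilityMeasure μ] {φ : X → K}

lemma convOp_symImage_apply [SecondCountableTopology K] [IsProbabilityMeasure (symImage μ φ)]
    (hφ : Continuous φ) (ξ : L2 K) :
    convOp (symImage μ φ) ξ =
      (2 : ℝ)⁻¹ • (∫ x, leftRegular (φ x) ξ ∂μ + ∫ x, leftRegular (φ x)⁻¹ ξ ∂μ) :=
  integral_symImage hφ (continuous_leftRegular ξ)

lemma convOp_symImage_of_fixed [SecondCountableTopology K] [IsProbabilityMeasure (symImage μ φ)]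
    (hφ : Continuous φ) {ξ : L2 K} (hξ : ∀ x, leftRegular (φ x) ξ = ξ) :
    convOp (symImage μ φ) ξ = ξ := by
  have h1 : ∀ x, leftRegular (φ x)⁻¹ ξ = ξ := fun x => by
    conv_lhs => rw [← hξ x]
    exact leftRegular_inv_leftRegular _ _
  rw [convOp_symImage_apply hφ]
  simp only [hξ, h1, integral_const, probReal_univ, one_smul]
  rw [← two_smul ℝ ξ, smul_smul]
  norm_num

end CompactGroup

section Product

variable {Γ Λ : ℕ → Type} [∀ n, TopologicalSpace (Γ n)] [∀ n, Group (Γ n)]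
  [∀ n, DiscreteTopology (Γ n)] [∀ n, Fintype (Γ n)] [∀ n, MeasurableSpace (Γ n)]
  [∀ n, BorelSpace (Γ n)]
  [∀ n, TopologicalSpace (Λ n)] [∀ n, AddCommGroup (Λ n)]
  [∀ n, DiscreteTopology (Λ n)] [∀ n, Fintype (Λ n)] [∀ n, MeasurableSpace (Λ n)]
  [∀ n, BorelSpace (Λ n)] {μ : Measure (∀ n, Λ n)} [IsProbabilityMeasure μ]
  [μ.IsAddRightInvariant] {φ : (∀ n, Λ n) → ∀ n, Γ n} [IsProbabilityMeasure (symImage μ φ)]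
  {ε : ℕ → ℝ}

lemma norm_convOp_symImage_le (hφ : Continuous φ)
    (h1 : ∀ n (x : ∀ n, Λ n) (a : Λ n), ∀ m < n, φ (x + Pi.single n a) m = φ x m)
    (h2 : ∀ n (x : ∀ n, Λ n), HasSmallAverages (fun a : Λ n => φ (x + Pi.single n a) n) (ε n))
    (hε : Antitone ε) (hε0 : ∀ n, 0 ≤ ε n) (n : ℕ) (ξ : L2 (∀ n, Γ n)) (hξ : ξ ∈ (cylL2 Γ n)ᗮ) :
    ‖convOp (symImage μ φ) ξ‖ ≤ ε n * ‖ξ‖ := by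
  refine norm_apply_le_of_mem_orthogonal cylL2_mono topologicalClosure_iSup_cylL2
    (fun n ξ hξ => convOp_mem _ leftRegular_mem_cylL2 hξ)
    (fun n ξ hξ => convOp_mem_orthogonal _ leftRegular_mem_cylL2 hξ) hε hε0 ?_ n hξ
  intro n ξ hξ hξ'
  rw [convOp_symImage_apply hφ, norm_smul]
  have e1 := norm_integral_leftRegular_le (μ := μ) hφ (h1 n) (h2 n) hξ hξ'
  have e2 := norm_integral_leftRegular_le (μ := μ) hφ.inv (n := n) (ε := ε n)
    (fun x a m hm => by simp [h1 n x a m hm]) (fun x => (h2 n x).inv) hξ hξ'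
  have e3 := (norm_add_le _ _).trans (add_le_add e1 e2)
  simp only [Pi.inv_apply] at e3
  have e4 : ‖(2 : ℝ)⁻¹‖ = 2⁻¹ := by norm_num
  rw [e4]
  linarith

end Product

/-! ### Topological generation from a spectral gap -/

section Generation

variable {Γ : ℕ → Type} [∀ n, TopologicalSpace (Γ n)] [∀ n, Group (Γ n)]
  [∀ n, DiscreteTopology (Γ n)] [∀ n, Fintype (Γ n)] [∀ n, MeasurableSpace (Γ n)]
  [∀ n, BorelSpace (Γ n)] {X : Type*} [TopologicalSpace X] [MeasurableSpace X] [BorelSpace X]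
  {μ : Measure X} [IsProbabilityMeasure μ] {φ : X → ∀ n, Γ n} [IsProbabilityMeasure (symImage μ φ)]

/-- If `λ(ν)` is a strict contraction on the functions of mean zero, then the support of `ν`
generates a dense subgroup. -/
lemma topologicalClosure_closure_range_eq_top (hφ : Continuous φ) {c : ℝ} (hc : c < 1)
    (h : ∀ ξ ∈ (cylL2 Γ 0)ᗮ, ‖convOp (symImage μ φ) ξ‖ ≤ c * ‖ξ‖) :
    (Subgroup.closure (Set.range φ)).topologicalClosure = ⊤ := by
  classical
  set H := Subgroup.closure (Set.range φ)
  rw [Subgroup.eq_top_iff']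
  intro k
  by_contra hk
  obtain ⟨n, hn⟩ := exists_cylinder_subset_of_mem_nhds
    (H.isClosed_topologicalClosure.isOpen_compl.mem_nhds hk)
  -- `S` is the product of `H` with the open subgroup of elements trivial in the first `n`
  -- coordinates; it is clopen, invariant under `H`, and misses `k`.
  let S : Set (∀ n, Γ n) := {y | ∃ g ∈ H, ∀ m < n, g m = y m}
  have hS : ∀ x y : ∀ n, Γ n, (∀ m < n, x m = y m) → (x ∈ S ↔ y ∈ S) := fun x y hxy => by
    refine ⟨fun ⟨g, hg, h⟩ => ⟨g, hg, fun m hm => (h m hm).trans (hxy m hm)⟩,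
      fun ⟨g, hg, h⟩ => ⟨g, hg, fun m hm => (h m hm).trans (hxy m hm).symm⟩⟩
  have hSc : IsClopen S := by
    have : ∀ P : Set (∀ n, Γ n), (∀ x y : ∀ n, Γ n, (∀ m < n, x m = y m) → x ∈ P → y ∈ P) →
        IsOpen P := fun P hP => isOpen_iff_mem_nhds.2 fun x hx =>
      mem_of_superset ((PiNat.isOpen_cylinder Γ x n).mem_nhds (PiNat.self_mem_cylinder x n))
        fun y hy => hP x y (fun m hm => (hy m hm).symm) hx
    exact ⟨⟨this _ fun x y hxy hx hy => hx ((hS x y hxy).2 hy)⟩,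
      this _ fun x y hxy hx => (hS x y hxy).1 hx⟩
  let f : C(∀ n, Γ n, ℂ) := ⟨S.indicator fun _ => 1,
    continuous_const.indicator (by simp [hSc.frontier_eq])⟩
  have hf : ∀ y, f y = if y ∈ S then 1 else 0 := fun y => Set.indicator_apply S (fun _ => (1 : ℂ)) y
  have hfix : ∀ x, leftRegular (φ x) (contToL2 f) = contToL2 f := fun x => by
    have hx : φ x ∈ H := Subgroup.subset_closure ⟨x, rfl⟩
    rw [leftRegular_contToL2]
    congr 1
    ext y
    have : (φ x)⁻¹ * y ∈ S ↔ y ∈ S := by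
      constructor
      · rintro ⟨g, hg, h⟩
        exact ⟨φ x * g, H.mul_mem hx hg, fun m hm => by simp [h m hm]⟩
      · rintro ⟨g, hg, h⟩
        exact ⟨(φ x)⁻¹ * g, H.mul_mem (H.inv_mem hx) hg, fun m hm => by simp [h m hm]⟩
    rw [leftTranslate_apply, hf, hf, if_congr this rfl rfl]
  set ξ := contToL2 f
  set η := (cylL2 Γ 0).starProjection ξ
  have hη : η ∈ cylL2 Γ 0 := Submodule.starProjection_apply_mem _ _
  have hηfix : convOp (symImage μ φ) η = η := convOp_symImage_of_fixed hφ fun x => by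
    rw [leftRegular_eq_of_mem_cylL2 (y := 1) (by simp) hη, leftRegular_one]
  -- A fixed vector orthogonal to the constants is contracted by `c < 1`, hence zero. So the
  -- indicator of `S` is constant, although it is `1` at the identity and `0` at `k`.
  have h0 : ξ - η = 0 := by
    have h3 := h (ξ - η) (Submodule.sub_starProjection_mem_orthogonal ξ)
    rw [map_sub, hηfix, convOp_symImage_of_fixed hφ hfix] at h3
    have := norm_nonneg (ξ - η)
    rw [← norm_eq_zero]
    nlinarith
  rw [← sub_eq_zero.1 h0] at hη
  obtain ⟨g, hg, hgξ⟩ := hη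
  have hgf : g = f := contToL2_injective hgξ
  have h1 : f 1 = f k := by rw [← hgf]; exact hg _ _ (by simp)
  have h2 : (1 : ∀ n, Γ n) ∈ S := ⟨1, H.one_mem, by simp⟩
  have h3 : k ∉ S := by
    rintro ⟨g, hg, h⟩
    exact hn (fun m hm => h m hm) (H.le_topologicalClosure hg)
  rw [hf, hf, if_pos h2, if_neg h3] at h1
  exact one_ne_zero h1

end Generation

section Haar

variable {Λ : ℕ → Type} [∀ n, TopologicalSpace (Λ n)] [∀ n, AddCommGroup (Λ n)]
  [∀ n, DiscreteTopology (Λ n)] [∀ n, Nontrivial (Λ n)]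

/-- Without isolated points, Haar measure on the product has no atoms. -/
lemma nhdsNE_zero_neBot_pi : (𝓝[≠] (0 : ∀ n, Λ n)).NeBot := by
  rw [← mem_closure_iff_nhdsWithin_neBot, mem_closure_iff_nhds]
  intro t ht
  obtain ⟨n, hn⟩ := exists_cylinder_subset_of_mem_nhds ht
  obtain ⟨a, ha⟩ := exists_ne (0 : Λ n)
  refine ⟨Pi.single n a, hn fun m hm => Pi.single_eq_of_ne hm.ne a, ?_⟩
  simpa using ha

end Haar

lemma continuous_of_forall_cylinder {E : ℕ → Type*} [∀ n, TopologicalSpace (E n)]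
    [∀ n, DiscreteTopology (E n)] {Y : Type*} [TopologicalSpace Y] {f : (∀ n, E n) → Y} (n : ℕ)
    (hf : ∀ x y : ∀ n, E n, (∀ m < n, x m = y m) → f x = f y) : Continuous f :=
  IsLocallyConstant.continuous <| (IsLocallyConstant.iff_exists_open f).2 fun x =>
    ⟨_, PiNat.isOpen_cylinder E x n, PiNat.self_mem_cylinder x n, fun y hy => hf y x hy⟩

/-! ### Families with rows indexed by prefixes -/

section Coding

/-- The number of rows `N (n + 1) = N n * r n` depends on earlier choices, so a family is chosen for
every possible `N` before the recursion is run. The `+ 2` makes every girth at least `2`, which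
gives injectivity, and every average bound at most `1 / 2`, which gives generation. -/
lemma exists_coded_families :
    ∃ (p : ℕ → Nat.Primes) (r : ℕ → ℕ) (N : ℕ → ℕ) (h : ∀ n, Fin (N n) × Fin (r n) → PGLTwo (p n))
      (c : ∀ n, (∀ n, Fin (r n)) → Fin (N n)),
      Tendsto (fun n => (p n : ℕ)) atTop atTop ∧ (∀ n, 2 ≤ r n) ∧
      (∀ n, HasLargeGirth (h n) (n + 2)) ∧
      (∀ n i, HasSmallAverages (fun j => h n (i, j)) (1 / (n + 2))) ∧
      ∀ n x y, c n x = c n y ↔ ∀ m < n, x m = y m := by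
  choose p hp r hr h hg ha using fun (n : ℕ) (N : {N : ℕ // 0 < N}) =>
    exists_family N.1 (n + 2) n N.2 (ε := 1 / ((n : ℝ) + 2)) (by positivity)
  let N : ℕ → {N : ℕ // 0 < N} := fun n => Nat.rec ⟨1, one_pos⟩
    (fun n N => ⟨N.1 * r n N, Nat.mul_pos N.2 (by have := hr n N; lia)⟩) n
  let c : ∀ n, (∀ n, Fin (r n (N n))) → Fin (N n).1 := fun n x => Nat.rec (0 : Fin 1)
    (fun n i => (finProdFinEquiv (i, x n) : Fin ((N n).1 * r n (N n)))) n
  have hc : ∀ n x, c (n + 1) x = (finProdFinEquiv (c n x, x n) : Fin ((N n).1 * r n (N n))) :=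
    fun _ _ => rfl
  refine ⟨fun n => p n (N n), fun n => r n (N n), fun n => (N n).1, fun n => h n (N n), c,
    tendsto_atTop_mono (fun n => hp n (N n)) tendsto_id, fun n => hr n (N n),
    fun n => hg n (N n), fun n => ha n (N n), fun n x y => ?_⟩
  induction n with
  | zero =>
    exact ⟨fun _ m hm => absurd hm (Nat.not_lt_zero m), fun _ =>
      Subsingleton.elim (α := Fin 1) _ _⟩
  | succ n ih =>
    rw [hc, hc]
    refine (finProdFinEquiv.injective.eq_iff).trans ?_
    rw [Prod.mk.injEq, ih]
    refine ⟨fun ⟨h1, h2⟩ m hm => ?_, fun h => ⟨fun m hm => h m (hm.trans (Nat.lt_succ_self n)),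
      h n (Nat.lt_succ_self n)⟩⟩
    rcases Nat.lt_succ_iff_lt_or_eq.1 hm with hm | rfl
    · exact h1 m hm
    · exact h2

end Coding

/-! ### Freeness from growing girth -/

section Free

variable {Γ : ℕ → Type*} [∀ n, Group (Γ n)] {X : Type*} {ι : ℕ → Type*}

lemma HasLargeGirth.injective {G ι : Type*} [Group G] {h : ι → G} {ℓ : ℕ}
    (hh : HasLargeGirth h ℓ) (hℓ : 2 ≤ ℓ) : Function.Injective h := by
  intro i j hij
  by_contra hne
  refine hh [(i, true), (j, false)] (by simp) (by simpa using hℓ) ?_ ?_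
  · simpa using hne
  · simp [listWord, hij]

/-- A family in a product whose coordinates have larger and larger girth is free. -/
lemma isFreeSubset_range (e : ∀ n, X → ι n) (h : ∀ n, ι n → Γ n)
    (hh : ∀ n, HasLargeGirth (h n) (n + 2))
    (he : ∀ x y, x ≠ y → ∀ᶠ n in atTop, e n x ≠ e n y) :
    IsFreeSubset (Set.range fun x n => h n (e n x)) := by
  intro w hw0 hwF hw
  set φ : X → ∀ n, Γ n := fun x n => h n (e n x)
  have hX : Nonempty X := by
    obtain ⟨a, ha⟩ := List.exists_mem_of_ne_nil w hw0
    obtain ⟨x, -⟩ := hwF a ha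
    exact ⟨x⟩
  set ψ := Function.invFun φ
  have hψ : ∀ a ∈ w, φ (ψ a.1) = a.1 := fun a ha => Function.invFun_eq (hwF a ha)
  -- A word has finitely many letters, so one late coordinate separates all of them and the word
  -- remains reduced there.
  have hev : ∀ᶠ n in atTop, ∀ a ∈ w, ∀ b ∈ w, ψ a.1 ≠ ψ b.1 → e n (ψ a.1) ≠ e n (ψ b.1) := by
    have h1 : ∀ a b, ∀ᶠ n in atTop, ψ a ≠ ψ b → e n (ψ a) ≠ e n (ψ b) := fun a b => by
      by_cases hab : ψ a = ψ b
      · simp [hab]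
      · filter_upwards [he _ _ hab] with n hn _ using hn
    exact (eventually_all_finite (List.finite_toSet w)).2 fun a _ =>
      (eventually_all_finite (List.finite_toSet w)).2 fun b _ => h1 a.1 b.1
  obtain ⟨n, hn, hnw⟩ := (hev.and (eventually_ge_atTop w.length)).exists
  intro hprod
  set L := w.map fun a => (e n (ψ a.1), a.2)
  refine hh n L (by simpa [L] using hw0) (by simp [L]; lia) ?_ ?_
  · rw [List.isChain_map]
    refine hw.imp_of_mem_imp fun a b ha hb hab heq => hab ?_
    rw [← hψ a ha, ← hψ b hb]
    exact congrArg φ (not_imp_not.1 (hn a ha b hb) heq)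
  · have h0 := congrFun hprod n
    rw [Pi.list_prod_apply] at h0
    refine Eq.trans ?_ h0
    rw [listWord, List.map_map, List.map_map]
    congr 1
    refine List.map_congr_left fun a ha => ?_
    have h1 : h n (e n (ψ a.1)) = a.1 n := congrFun (hψ a ha) n
    simp only [Function.comp_apply, h1]
    split_ifs <;> rfl

end Free

end

theorem theorem7p5 :
    ∃ p : ℕ → Nat.Primes, Tendsto (fun n => (p n : ℕ)) atTop atTop ∧
      ∃ (F : Set (ProdPGLTwo p)) (ν : ProbabilityMeasure (ProdPGLTwo p)),
        IsClosed F ∧ IsFreeSubset F ∧ (Subgroup.closure F).topologicalClosure = ⊤ ∧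
        (ν : Measure (ProdPGLTwo p)).IsInvInvariant ∧
        NullSingletonClass (ν : Measure (ProdPGLTwo p)) ∧
        IsC0 (ν : Measure (ProdPGLTwo p)) ∧
        (ν : Measure (ProdPGLTwo p)).support = F ∪ F⁻¹ := by
  obtain ⟨p, r, N, h, c, hp, hr, hg, ha, hc⟩ := exists_coded_families
  have : ∀ n, NeZero (r n) := fun n => ⟨by have := hr n; lia⟩
  have : ∀ n, Nontrivial (Fin (r n)) := fun n => Fin.nontrivial_iff_two_le.2 (hr n)
  have : (𝓝[≠] (0 : ∀ n, Fin (r n))).NeBot := nhdsNE_zero_neBot_pi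
  set μ : Measure (∀ n, Fin (r n)) := Measure.addHaarMeasure ⊤
  have : IsProbabilityMeasure μ := ⟨Measure.addHaarMeasure_self⟩
  -- The code `c n x` of the prefix selects the row, and `x n` the entry.
  set φ : (∀ n, Fin (r n)) → ProdPGLTwo p := fun x n => h n (c n x, x n) with hφdef
  have hcode : ∀ n (x y : ∀ n, Fin (r n)), (c n x, x n) = (c n y, y n) ↔
      ∀ m < n + 1, x m = y m := fun n x y => by
    rw [Prod.mk.injEq, hc]
    refine ⟨fun h m hm => ?_, fun h => ⟨fun m hm => h m (by lia), h n (by lia)⟩⟩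
    rcases Nat.lt_succ_iff_lt_or_eq.1 hm with hm | rfl
    · exact h.1 m hm
    · exact h.2
  have hφ : Continuous φ := continuous_pi fun n => continuous_of_forall_cylinder (n + 1)
    fun x y hxy => congrArg (h n) ((hcode n x y).2 hxy)
  have hinj : Function.Injective φ := fun x y hxy => funext fun n =>
    (Prod.ext_iff.1 ((hg n).injective (by lia) (congrFun hxy n))).2
  have h1 : ∀ n (x : ∀ n, Fin (r n)) (a : Fin (r n)), ∀ m < n,
      φ (x + Pi.single n a) m = φ x m := fun n x a m hm =>
    congrArg (h m) ((hcode m _ _).2 fun k hk => by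
      simp [Pi.single_eq_of_ne (M := fun n => Fin (r n)) (show k ≠ n by lia)])
  have h2 : ∀ n (x : ∀ n, Fin (r n)),
      HasSmallAverages (fun a : Fin (r n) => φ (x + Pi.single n a) n) (1 / ((n : ℝ) + 2)) := by
    intro n x
    -- Changing the `n`-th coordinate keeps the row `c n x` and runs once through its entries.
    convert (ha n (c n x)).comp_equiv (Equiv.addLeft (x n)) using 1
    ext a
    have : c n (x + Pi.single n a) = c n x := (hc _ _ _).2 fun m hm => by
      simp [Pi.single_eq_of_ne (M := fun n => Fin (r n)) hm.ne]
    simp [hφdef, this]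
  have hε : Antitone fun n : ℕ => 1 / ((n : ℝ) + 2) := fun m n hmn => by
    have : (m : ℝ) ≤ n := by exact_mod_cast hmn
    exact one_div_le_one_div_of_le (by positivity) (by linarith)
  have hε0 : ∀ n : ℕ, 0 ≤ 1 / ((n : ℝ) + 2) := fun n => by positivity
  have hεlim : Tendsto (fun n : ℕ => 1 / ((n : ℝ) + 2)) atTop (𝓝 0) := by
    have := (tendsto_const_div_atTop_nhds_zero_nat (1 : ℝ)).comp (tendsto_add_atTop_nat 2)
    simpa [Function.comp_def] using this
  have hprob : IsProbabilityMeasure (symImage μ φ) := isProbabilityMeasure_symImage hφ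
  have hnorm := norm_convOp_symImage_le (μ := μ) hφ h1 h2 hε hε0
  refine ⟨p, hp, Set.range φ, ⟨symImage μ φ, hprob⟩, (isCompact_range hφ).isClosed, ?_, ?_,
    isInvInvariant_symImage hφ, nullSingletonClass_symImage hφ hinj, ?_, support_symImage hφ⟩
  · refine isFreeSubset_range (fun n x => (c n x, x n)) h hg fun x y hxy => ?_
    obtain ⟨m, hm⟩ := Function.ne_iff.1 hxy
    filter_upwards [eventually_ge_atTop m] with n hn heq
    exact hm ((hcode n x y).1 heq m (by lia))
  · exact topologicalClosure_closure_range_eq_top hφ (c := 1 / 2) (by norm_num)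
      (by simpa using hnorm 0)
  · exact isCompactOperator_of_norm_apply_le_on_orthogonal hnorm hε0 hεlim
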